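/- **Conventions.** An algebra is a commutative, associative, unital $\mathbb{R}$-algebra, and algebra homomorphisms preserve units. For an algebra $A$, $|A|$ is the set of algebra homomorphisms $p:A\to\mathbb{R}$ ("points"), with the weak topology, the coarsest one making every $p\mapsto p(f)$, $f\in A$, continuous; a homomorphism $\psi:A\to B$ induces $|\psi|:|B|\to|A|$, $q\mapsto q\circ\psi$. For $S\subseteq|A|$, $A_{|S}$ is the algebra of functions $S\to\mathbb{R}$ that, near every point of $S$, agree on $S$ with $p\mapsto p(f)$ for some $f\in A$. $A$ is *geometric* if $\bigcap_{p\in|A|}\ker p=0$, *complete* if the map $A\to A_{||A|}$ is surjective, and a *smooth algebra of dimension $n$* if it is geometric and complete and $|A|$ has a (finite or) countable open cover $\{U_k\}$ with $A_{|U_k}\cong C^\infty(\mathbb{R}^n)$ for all $k$. In that case $|A|$ is a smooth $n$-manifold whose charts are the maps $|i\circ\rho_U|^{-1}:U\to\mathbb{R}^n=|C^\infty(\mathbb{R}^n)|$, where $U\subseteq|A|$ is open, $\rho_U:A\to A_{|U}$ is the restriction, and $i:A_{|U}\to C^\infty(\mathbb{R}^n)$ is an isomorphism. **The category EA.** Let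 $A$ be a smooth algebra of dimension $4$ and let $\hat\Gamma(A)$ be the $A$-module of derivations of $A$. For $p\in|A|$ put $\hat X_p(f)=p(\hat X(f))$ and $T_pA=\{\hat X_p:\hat X\in\hat\Gamma(A)\}$. A *metric* on $A$ is an isomorphism of $A$-modules $\hat g:\hat\Gamma(A)\to\hat\Gamma^*(A)=\mathrm{Hom}_A(\hat\Gamma(A),A)$ with $\hat g(\hat X)(\hat Y)=\hat g(\hat Y)(\hat X)$; it induces a form on each $T_pA$ by $\hat g(\hat X_p,\hat Y_p)=p(\hat g(\hat X)(\hat Y))$. It has *Lorentz signature* if every $T_pA$ has a basis $\xi_1,\dots,\xi_4$ with $\hat g(\xi_i,\xi_j)=0$ for $i\ne j$, $\hat g(\xi_1,\xi_1)=1$ and $\hat g(\xi_i,\xi_i)=-1$ for $i=2,3,4$. The objects of $\mathbf{EA}$ are the Einstein algebras $(A,\hat g)$: a smooth algebra $A$ of dimension $4$ with a metric $\hat g$ of Lorentz signature. The arrows $(A,\hat g)\to(B,\hat g')$ are the algebra homomorphisms $\psi:A\to B$ with $\psi_*\hat g=\hat g'$, i.e. $\hat g(\psi^*\hat X_q,\psi^*\hat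 Y_q)=q(\hat g'(\hat X)(\hat Y))$ for all $\hat X,\hat Y\in\hat\Gamma(B)$ and $q\in|B|$, where $\psi^*\hat X_q=\hat X_q\circ\psi\in T_{|\psi|(q)}A$. **The category GR.** The objects are relativistic spacetimes $(M,g)$: a smooth Hausdorff second countable $4$-manifold $M$ (not necessarily connected) with a smooth Lorentzian metric $g$ of signature $(1,3)$. The arrows $(M,g)\to(M',g')$ are the (not necessarily invertible) isometries: smooth maps $\varphi:M\to M'$ with $\varphi^*g'=g$. **Theorem.** The categories $\mathbf{EA}$ and $\mathbf{GR}$ are dual, that is, there are contravariant functors between them whose two composites are naturally isomorphic to the identity functors. More precisely: 1. $J(M,g)=(C^\infty(M),\hat g)$, $J(\varphi)(f)=f\circ\varphi$, is a well-defined contravariant functor $\mathbf{GR}\to\mathbf{EA}$. Here $\hat g(\hat X)(\hat Y)=g(X,Y)$, where the derivation $\hat X$ and the vector field $X$ on $M$ correspond by $\hat X(f)(x)=X_x(f)$. 2. $K(A,\hat g)=(|A|,|\hat g|)$, $K(\psi)=|\psi|$, is a well-defined contravariant functor $\mathbf{EA}\to\mathbf{GR}$. Here $|\hat g|(X_p,Y_p)=p(\hat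 g(\hat X)(\hat Y))$ whenever $X_p$ and $\hat X_p$ (and likewise $Y_p$ and $\hat Y_p$) correspond under the identification of $f\in A$ with the function $p\mapsto p(f)$ on $|A|$. 3. The maps $\eta_{(A,\hat g)}:A\to C^\infty(|A|)$, $\eta(f)(p)=p(f)$, are the components of a natural isomorphism $1_{\mathbf{EA}}\Rightarrow J\circ K$. 4. The maps $\theta_{(M,g)}:M\to|C^\infty(M)|$, $\theta(x)(f)=f(x)$, are the components of a natural isomorphism $1_{\mathbf{GR}}\Rightarrow K\circ J$. -/

import Mathlib

open scoped Manifold ContDiff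
open CategoryTheory Opposite

universe u

namespace EinsteinAlg

noncomputable section

/-! ## Smooth algebras -/

/-- `E n` is `ℝⁿ`. -/
abbrev E (n : ℕ) : Type := EuclideanSpace ℝ (Fin n)

/-- The algebra `C^∞(M)` of smooth real functions on an `n`-dimensional manifold `M`. -/
abbrev SmoothFn (n : ℕ) (M : Type u) [TopologicalSpace M] [ChartedSpace (E n) M] : Type u :=
  C^∞⟮𝓡 n, M; 𝓘(ℝ, ℝ), ℝ⟯

section Algebras

variable {A : Type u} [CommRing A] [Algebra ℝ A]

/-- The dual space of points `|A|`: all unital algebra homomorphisms `A → ℝ`. -/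
def Points (A : Type u) [CommRing A] [Algebra ℝ A] : Type u := A →ₐ[ℝ] ℝ

instance : FunLike (Points A) A ℝ := inferInstanceAs (FunLike (A →ₐ[ℝ] ℝ) A ℝ)

instance : AlgHomClass (Points A) ℝ A ℝ := inferInstanceAs (AlgHomClass (A →ₐ[ℝ] ℝ) ℝ A ℝ)

/-- The weak topology: the coarsest topology on `|A|` making every `p ↦ p f`, `f ∈ A`,
continuous. -/
instance : TopologicalSpace (Points A) :=
  ⨅ f : A, TopologicalSpace.induced (fun p : Points A => p f) inferInstance

theorem Points.continuous_apply (f : A) : Continuous (fun p : Points A => p f) :=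
  continuous_iInf_dom (i := f) continuous_induced_dom

theorem Points.continuous_iff {X : Type*} [TopologicalSpace X] {h : X → Points A} :
    Continuous h ↔ ∀ f : A, Continuous (fun x => h x f) := by
  rw [continuous_iInf_rng]
  exact forall_congr' fun f => continuous_induced_rng

theorem Points.ext {p q : Points A} (h : ∀ f : A, p f = q f) : p = q :=
  DFunLike.ext p q h

instance : T2Space (Points A) := by
  refine ⟨fun p q hpq => ?_⟩
  have : ∃ f : A, p f ≠ q f := by
    by_contra! hh
    exact hpq (Points.ext hh)
  obtain ⟨f, hf⟩ := this
  obtain ⟨u, v, hu, hv, hpu, hqv, huv⟩ := t2_separation hf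
  exact ⟨_, _, hu.preimage (Points.continuous_apply f), hv.preimage (Points.continuous_apply f),
    hpu, hqv, huv.preimage _⟩

/-- The map `|ψ| : |B| → |A|`, `x ↦ x ∘ ψ`. -/
def pointsMap {B : Type u} [CommRing B] [Algebra ℝ B] (ψ : A →ₐ[ℝ] B) (q : Points B) : Points A :=
  AlgHom.comp (show B →ₐ[ℝ] ℝ from q) ψ

@[simp] theorem pointsMap_apply {B : Type u} [CommRing B] [Algebra ℝ B] (ψ : A →ₐ[ℝ] B)
    (q : Points B) (f : A) : pointsMap ψ q f = q (ψ f) := rfl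

/-- `A` is geometric: only `0` lies in the kernel of all points. -/
def IsGeometric (A : Type u) [CommRing A] [Algebra ℝ A] : Prop :=
  ∀ f : A, (∀ p : Points A, p f = 0) → f = 0

/-- The restriction `A_{|S}`: the functions on `S ⊆ |A|` that agree, in a neighbourhood of each
point of `S`, with an element of `A`. -/
def restriction (S : Set (Points A)) : Subalgebra ℝ (S → ℝ) where
  carrier := {f | ∀ x : S, ∃ O : Set (Points A), IsOpen O ∧ (x : Points A) ∈ O ∧
    ∃ a : A, ∀ y : S, (y : Points A) ∈ O → f y = (y : Points A) a}
  mul_mem' := by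
    intro f g hf hg x
    obtain ⟨O, hO, hx, a, ha⟩ := hf x
    obtain ⟨O', hO', hx', b, hb⟩ := hg x
    exact ⟨O ∩ O', hO.inter hO', ⟨hx, hx'⟩, a * b, fun y hy => by
      simp [ha y hy.1, hb y hy.2]⟩
  add_mem' := by
    intro f g hf hg x
    obtain ⟨O, hO, hx, a, ha⟩ := hf x
    obtain ⟨O', hO', hx', b, hb⟩ := hg x
    exact ⟨O ∩ O', hO.inter hO', ⟨hx, hx'⟩, a + b, fun y hy => by
      simp [ha y hy.1, hb y hy.2]⟩
  algebraMap_mem' := by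
    intro r x
    exact ⟨Set.univ, isOpen_univ, trivial, algebraMap ℝ A r, fun y _ => by
      simp [AlgHomClass.commutes]⟩

/-- The restriction homomorphism `ρ_S : A → A_{|S}`. -/
def restrictHom (S : Set (Points A)) : A →ₐ[ℝ] restriction S where
  toFun a := ⟨fun p => (p : Points A) a,
    fun _ => ⟨Set.univ, isOpen_univ, trivial, a, fun _ _ => rfl⟩⟩
  map_one' := by ext p; simp
  map_mul' a b := by ext p; simp
  map_zero' := by ext p; simp
  map_add' a b := by ext p; simp
  commutes' r := by ext p; simp [AlgHomClass.commutes]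

@[simp] theorem restrictHom_apply (S : Set (Points A)) (a : A) (p : S) :
    (restrictHom S a : S → ℝ) p = (p : Points A) a := rfl

/-- `A` is complete: every function on `|A|` that is locally given by elements of `A` is given by
an element of `A`. -/
def IsCompleteAlg (A : Type u) [CommRing A] [Algebra ℝ A] : Prop :=
  Function.Surjective (restrictHom (A := A) Set.univ)

/-- `A` is a smooth algebra of dimension `n`. -/
structure IsSmoothAlg (n : ℕ) (A : Type u) [CommRing A] [Algebra ℝ A] : Prop where
  geometric : IsGeometric A
  complete : IsCompleteAlg A
  cover : ∃ 𝒰 : Set (Set (Points A)), 𝒰.Countable ∧ ⋃₀ 𝒰 = Set.univ ∧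
    ∀ U ∈ 𝒰, IsOpen U ∧ Nonempty (restriction U ≃ₐ[ℝ] SmoothFn n (E n))

/-! ## The manifold `|A|` of a smooth algebra -/

theorem restriction_continuous {S : Set (Points A)} (f : restriction S) :
    Continuous (f : S → ℝ) := by
  rw [continuous_iff_continuousAt]
  intro x
  obtain ⟨O, hO, hx, a, ha⟩ := f.2 x
  have h1 : ContinuousAt (fun y : S => (y : Points A) a) x :=
    ((Points.continuous_apply a).comp continuous_subtype_val).continuousAt
  refine h1.congr ?_
  filter_upwards [(hO.preimage continuous_subtype_val).mem_nhds hx] with y hy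
  exact (ha y hy).symm

theorem mem_restriction_of_local {S : Set (Points A)} {v : S → ℝ}
    (h : ∀ x : S, ∃ O : Set S, IsOpen O ∧ x ∈ O ∧ ∃ w : restriction S, ∀ y ∈ O,
      v y = (w : S → ℝ) y) : v ∈ restriction S := by
  intro x
  obtain ⟨O, hO, hx, w, hw⟩ := h x
  obtain ⟨O₁, hO₁, hx₁, a, ha⟩ := w.2 x
  obtain ⟨O₂, hO₂, rfl⟩ := isOpen_induced_iff.1 hO
  exact ⟨O₂ ∩ O₁, hO₂.inter hO₁, ⟨hx, hx₁⟩, a, fun y hy => by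
    rw [hw y hy.1, ha y hy.2]⟩

variable {n : ℕ}

/-- The `j`-th coordinate function on `ℝⁿ`. -/
def coordFn (j : Fin n) : SmoothFn n (E n) :=
  ⟨fun x => x j, by rw [contMDiff_iff_contDiff]; fun_prop⟩

/-- Every homomorphism `C^∞(ℝⁿ) → ℝ` is evaluation at a point. -/
theorem exists_eval (χ : SmoothFn n (E n) →ₐ[ℝ] ℝ) : ∃ x : E n, ∀ f, χ f = f x := by
  let a : E n := WithLp.toLp 2 fun j => χ (coordFn j)
  refine ⟨a, fun f => ?_⟩
  let g : SmoothFn n (E n) :=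
    ∑ j, (coordFn j - algebraMap ℝ _ (χ (coordFn j))) ^ 2 + (f - algebraMap ℝ _ (χ f)) ^ 2
  have hg : χ g = 0 := by simp [g]
  have hgx : ∀ x, g x = ∑ j, (x j - a j) ^ 2 + (f x - χ f) ^ 2 := by
    intro x
    have : g x = ContMDiffMap.evalRingHom x g := rfl
    rw [this]
    simp only [g, map_add, map_sum, map_pow, map_sub]
    rfl
  have h0 : ∃ y, g y = 0 := by
    by_contra! hne
    let k : SmoothFn n (E n) := ⟨fun x => (g x)⁻¹, g.contMDiff.inv₀ hne⟩
    have hk : g * k = 1 := by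
      ext x
      exact mul_inv_cancel₀ (hne x)
    have := congrArg χ hk
    simp [hg] at this
  obtain ⟨y, hy⟩ := h0
  rw [hgx] at hy
  have h1 : (0 : ℝ) ≤ ∑ j, (y j - a j) ^ 2 := Finset.sum_nonneg fun j _ => sq_nonneg _
  have h2 : ∑ j, (y j - a j) ^ 2 = 0 := by nlinarith [sq_nonneg (f y - χ f)]
  have h3 : f y - χ f = 0 := by
    have : (f y - χ f) ^ 2 = 0 := by nlinarith [sq_nonneg (f y - χ f)]
    exact pow_eq_zero_iff (two_ne_zero) |>.1 this
  have h4 : y = a := by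
    ext j
    have := (Finset.sum_eq_zero_iff_of_nonneg (fun j _ => sq_nonneg (y j - a j))).1 h2 j
      (Finset.mem_univ j)
    exact sub_eq_zero.1 (pow_eq_zero_iff (two_ne_zero) |>.1 this)
  rw [← h4]
  linarith

/-- The map `|h| : ℝⁿ → |A|` dual to `h = i ∘ ρ_U : A → C^∞(ℝⁿ)`. -/
def chartInv {U : Set (Points A)} (i : restriction U ≃ₐ[ℝ] SmoothFn n (E n)) (x : E n) :
    Points A :=
  show A →ₐ[ℝ] ℝ from
    { (ContMDiffMap.evalRingHom x).comp (i.toAlgHom.comp (restrictHom U)).toRingHom with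
      commutes' := fun r => by
        change i (restrictHom U (algebraMap ℝ A r)) x = r
        rw [AlgHom.commutes, AlgEquiv.commutes]
        rfl }

theorem chartInv_apply {U : Set (Points A)} (i : restriction U ≃ₐ[ℝ] SmoothFn n (E n)) (x : E n)
    (f : A) : chartInv i x f = i (restrictHom U f) x := rfl

theorem exists_chartPoint {U : Set (Points A)} (i : restriction U ≃ₐ[ℝ] SmoothFn n (E n))
    (q : U) : ∃ x : E n, ∀ F : SmoothFn n (E n), (i.symm F : U → ℝ) q = F x := by
  obtain ⟨x, hx⟩ := exists_eval
    ((Pi.evalAlgHom ℝ (fun _ : U => ℝ) q).comp ((restriction U).val.comp i.symm.toAlgHom))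
  exact ⟨x, fun F => hx F⟩

/-- The coordinates of a point `q ∈ U`. -/
def chartPoint {U : Set (Points A)} (i : restriction U ≃ₐ[ℝ] SmoothFn n (E n)) (q : U) : E n :=
  (exists_chartPoint i q).choose

theorem chartPoint_spec {U : Set (Points A)} (i : restriction U ≃ₐ[ℝ] SmoothFn n (E n)) (q : U)
    (F : SmoothFn n (E n)) : (i.symm F : U → ℝ) q = F (chartPoint i q) :=
  (exists_chartPoint i q).choose_spec F

theorem chartPoint_spec' {U : Set (Points A)} (i : restriction U ≃ₐ[ℝ] SmoothFn n (E n)) (q : U)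
    (u : restriction U) : (u : U → ℝ) q = i u (chartPoint i q) := by
  rw [← chartPoint_spec, AlgEquiv.symm_apply_apply]

theorem chartInv_chartPoint {U : Set (Points A)} (i : restriction U ≃ₐ[ℝ] SmoothFn n (E n))
    (q : U) : chartInv i (chartPoint i q) = q := by
  apply Points.ext
  intro f
  rw [chartInv_apply, ← chartPoint_spec', restrictHom_apply]

theorem continuous_chartPoint {U : Set (Points A)} (i : restriction U ≃ₐ[ℝ] SmoothFn n (E n)) :
    Continuous (chartPoint i) := by
  have : ∀ j, Continuous fun q => (chartPoint i q) j := by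
    intro j
    refine (restriction_continuous (i.symm (coordFn j))).congr fun q => ?_
    rw [chartPoint_spec]
    rfl
  exact (PiLp.continuous_toLp 2 _).comp (continuous_pi this)

theorem continuous_chartInv {U : Set (Points A)} (i : restriction U ≃ₐ[ℝ] SmoothFn n (E n)) :
    Continuous (chartInv i) := by
  rw [Points.continuous_iff]
  intro f
  exact (i (restrictHom U f)).contMDiff.continuous

theorem surjective_chartPoint {U : Set (Points A)} (i : restriction U ≃ₐ[ℝ] SmoothFn n (E n)) :
    Function.Surjective (chartPoint i) := by
  intro x
  by_contra! hne
  let d : SmoothFn n (E n) := ⟨fun z => ‖z - x‖ ^ 2, by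
    rw [contMDiff_iff_contDiff]
    exact (contDiff_id.sub contDiff_const).norm_sq ℝ⟩
  have hd : ∀ z, d z = ‖z - x‖ ^ 2 := fun _ => rfl
  let w : restriction U := i.symm d
  have hw : ∀ q, (w : U → ℝ) q = ‖chartPoint i q - x‖ ^ 2 := fun q => chartPoint_spec i q d
  have hwpos : ∀ q, 0 < (w : U → ℝ) q := by
    intro q
    rw [hw]
    have : chartPoint i q - x ≠ 0 := sub_ne_zero.2 (hne q)
    positivity
  have hv : (fun q => ((w : U → ℝ) q)⁻¹) ∈ restriction U := by
    apply mem_restriction_of_local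
    intro q₀
    set δ : ℝ := (w : U → ℝ) q₀ / 2 with hδ
    have hδpos : 0 < δ := half_pos (hwpos q₀)
    let φ : ℝ → ℝ := fun t => t + (1 - Real.smoothTransition (t / δ))
    have hφ : ContDiff ℝ ∞ φ :=
      contDiff_id.add (contDiff_const.sub
        (Real.smoothTransition.contDiff.comp (contDiff_id.div_const δ)))
    have hφpos : ∀ t, 0 ≤ t → φ t ≠ 0 := by
      intro t ht
      have h1 := Real.smoothTransition.le_one (t / δ)
      rcases ht.eq_or_lt with h | h
      · subst h
        simp [φ]
      · have : 0 < φ t := by simp only [φ]; linarith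
        exact this.ne'
    let F : SmoothFn n (E n) := ⟨fun z => (φ (d z))⁻¹, by
      refine ContMDiff.inv₀ (hφ.contMDiff.comp d.contMDiff) fun z => hφpos _ ?_
      rw [hd]; positivity⟩
    refine ⟨{q | δ < (w : U → ℝ) q}, isOpen_lt continuous_const (restriction_continuous w),
      half_lt_self (hwpos q₀), i.symm F, fun q hq => ?_⟩
    have hF : (i.symm F : U → ℝ) q = (φ (d (chartPoint i q)))⁻¹ := chartPoint_spec i q F
    rw [hF, hd, ← hw]
    have hq' : δ < (w : U → ℝ) q := hq
    have : Real.smoothTransition ((w : U → ℝ) q / δ) = 1 :=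
      Real.smoothTransition.one_of_one_le ((one_le_div hδpos).2 hq'.le)
    simp [φ, this]
  have hmul : w * ⟨_, hv⟩ = 1 := by
    ext q
    exact mul_inv_cancel₀ (hwpos q).ne'
  have h1 := congrArg (fun f => i f x) hmul
  simp only [map_mul, map_one] at h1
  have h2 : i w x = 0 := by simp [w, hd]
  have h3 : (i w * i ⟨_, hv⟩) x = i w x * i ⟨_, hv⟩ x := rfl
  rw [h3, h2, zero_mul] at h1
  exact zero_ne_one h1

theorem chartInv_mem {U : Set (Points A)} (i : restriction U ≃ₐ[ℝ] SmoothFn n (E n)) (x : E n) :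
    chartInv i x ∈ U := by
  obtain ⟨q, rfl⟩ := surjective_chartPoint i x
  rw [chartInv_chartPoint]
  exact q.2

theorem chartPoint_chartInv {U : Set (Points A)} (i : restriction U ≃ₐ[ℝ] SmoothFn n (E n))
    (x : E n) (h : chartInv i x ∈ U) : chartPoint i ⟨chartInv i x, h⟩ = x := by
  obtain ⟨q, rfl⟩ := surjective_chartPoint i x
  congr 1
  exact Subtype.ext (chartInv_chartPoint i q)

open Classical in
/-- The chart `ψ = |h|⁻¹ : U → ℝⁿ` of `|A|` given by an open set `U` and an isomorphism
`i : A_{|U} ≃ C^∞(ℝⁿ)`. -/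
def chart {U : Set (Points A)} (hU : IsOpen U) (i : restriction U ≃ₐ[ℝ] SmoothFn n (E n)) :
    OpenPartialHomeomorph (Points A) (E n) where
  toFun p := if h : p ∈ U then chartPoint i ⟨p, h⟩ else 0
  invFun := chartInv i
  source := U
  target := Set.univ
  map_source' _ _ := trivial
  map_target' x _ := chartInv_mem i x
  left_inv' p hp := by rw [dif_pos hp, chartInv_chartPoint]
  right_inv' x _ := by rw [dif_pos (chartInv_mem i x), chartPoint_chartInv]
  open_source := hU
  open_target := isOpen_univ
  continuousOn_toFun := by
    rw [continuousOn_iff_continuous_domRestrict]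
    refine (continuous_chartPoint i).congr fun q => ?_
    simp
  continuousOn_invFun := (continuous_chartInv i).continuousOn

/-- The charts of `|A|`. -/
def chartAtlas (n : ℕ) (A : Type u) [CommRing A] [Algebra ℝ A] :
    Set (OpenPartialHomeomorph (Points A) (E n)) :=
  {e | ∃ (U : Set (Points A)) (hU : IsOpen U) (i : restriction U ≃ₐ[ℝ] SmoothFn n (E n)),
    e = chart hU i}

theorem IsSmoothAlg.exists_chart (h : IsSmoothAlg n A) (p : Points A) :
    ∃ e ∈ chartAtlas n A, p ∈ e.source := by
  obtain ⟨𝒰, -, hcov, hU⟩ := h.cover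
  obtain ⟨U, hUm, hp⟩ : p ∈ ⋃₀ 𝒰 := hcov ▸ trivial
  obtain ⟨hUo, ⟨i⟩⟩ := hU U hUm
  exact ⟨chart hUo i, ⟨U, hUo, i, rfl⟩, hp⟩

/-- The manifold structure on the dual space `|A|` of a smooth algebra. -/
@[reducible] def IsSmoothAlg.chartedSpace (h : IsSmoothAlg n A) :
    ChartedSpace (E n) (Points A) where
  atlas := chartAtlas n A
  chartAt p := (h.exists_chart p).choose
  mem_chart_source p := (h.exists_chart p).choose_spec.2
  chart_mem_atlas p := (h.exists_chart p).choose_spec.1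

theorem IsSmoothAlg.isManifold (h : IsSmoothAlg n A) :
    let _ := h.chartedSpace
    IsManifold (𝓡 n) ∞ (Points A) := by
  let _ := h.chartedSpace
  refine isManifold_of_contDiffOn _ _ _ ?_
  rintro e e' ⟨U, hU, i, rfl⟩ ⟨U', hU', i', rfl⟩
  intro x hx
  have hx' : chartInv i x ∈ U' := hx.1.2
  apply ContDiffAt.contDiffWithinAt
  have key : ∀ j : Fin n, ContDiffAt ℝ ∞ (fun z => (chart hU' i' (chartInv i z)) j) x := by
    intro j
    obtain ⟨O, hO, hxO, a, ha⟩ := (i'.symm (coordFn j)).2 ⟨chartInv i x, hx'⟩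
    have hs : ContDiffAt ℝ ∞ (fun z => i (restrictHom U a) z) x :=
      (contMDiff_iff_contDiff.1 (i (restrictHom U a)).contMDiff).contDiffAt
    refine hs.congr_of_eventuallyEq ?_
    filter_upwards [(hO.preimage (continuous_chartInv i)).mem_nhds hxO,
      (hU'.preimage (continuous_chartInv i)).mem_nhds hx'] with z hz hz'
    have h1 := ha ⟨chartInv i z, hz'⟩ hz
    rw [chartPoint_spec] at h1
    have h2 : chart hU' i' (chartInv i z) = chartPoint i' ⟨chartInv i z, hz'⟩ := dif_pos hz'
    rw [h2, ← chartInv_apply, ← h1]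
    rfl
  exact contDiffAt_euclidean.2 key

theorem IsSmoothAlg.secondCountable (h : IsSmoothAlg n A) :
    SecondCountableTopology (Points A) := by
  obtain ⟨𝒰, hc, hcov, hU⟩ := h.cover
  have : Countable 𝒰 := hc.to_subtype
  have hsc : ∀ U : 𝒰, SecondCountableTopology (U : Set (Points A)) := by
    intro U
    obtain ⟨hUo, ⟨i⟩⟩ := hU U U.2
    exact (chart hUo i).toHomeomorphSourceTarget.secondCountableTopology
  exact TopologicalSpace.secondCountableTopology_of_countable_cover
    (U := fun U : 𝒰 => (U : Set (Points A))) (fun U => (hU U U.2).1)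
    (by rw [← Set.sUnion_eq_iUnion, hcov])

/-! ## Metrics on algebras -/

/-- The `A`-module of derivations of `A`. -/
abbrev Der (A : Type u) [CommRing A] [Algebra ℝ A] : Type u := Derivation ℝ A A

/-- `X ↦ X_p`, where `X_p(f) = X(f)(p)`. -/
def evalDer (p : Points A) : Der A →ₗ[ℝ] (A →ₗ[ℝ] ℝ) where
  toFun X := (AlgHomClass.toAlgHom p : A →ₐ[ℝ] ℝ).toLinearMap ∘ₗ X.toLinearMap
  map_add' X Y := by ext f; simp
  map_smul' r X := by ext f; simp

@[simp] theorem evalDer_apply (p : Points A) (X : Der A) (f : A) : evalDer p X f = p (X f) := rfl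

/-- The tangent space `T_pA`: the space of all `X_p`, `X` a derivation of `A`. -/
def tangentSpace (p : Points A) : Submodule ℝ (A →ₗ[ℝ] ℝ) := LinearMap.range (evalDer p)

/-- A metric on `A`: a symmetric module isomorphism from derivations to their dual. -/
structure AlgMetric (A : Type u) [CommRing A] [Algebra ℝ A] where
  toEquiv : Der A ≃ₗ[A] Module.Dual A (Der A)
  symm : ∀ X Y : Der A, toEquiv X Y = toEquiv Y X

/-- The map `T_pA × T_pA → ℝ`, `(X_p, Y_p) ↦ ĝ(X, Y)(p)`, as a relation: `ĝ.AtPoint p ξ ζ c` says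
that `ξ, ζ` belong to `T_pA` and that the map takes the value `c` at `(ξ, ζ)`. -/
def AlgMetric.AtPoint (g : AlgMetric A) (p : Points A) (ξ ζ : A →ₗ[ℝ] ℝ) (c : ℝ) : Prop :=
  ∃ X Y : Der A, evalDer p X = ξ ∧ evalDer p Y = ζ ∧ p (g.toEquiv X Y) = c

/-- The matrix `diag(1, -1, -1, -1)`. -/
def minkowski (i j : Fin 4) : ℝ := if i = j then (if i = 0 then 1 else -1) else 0

/-- The metric has signature `(1, 3)` at every point. -/
def AlgMetric.IsLorentz (g : AlgMetric A) : Prop :=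
  ∀ p : Points A, ∃ b : Module.Basis (Fin 4) ℝ (tangentSpace p),
    ∀ i j, g.AtPoint p (b i) (b j) (minkowski i j)

/-- The pullback `ψ^*(ξ)` of `ξ : B → ℝ` along `ψ : A → B`, `ψ^*(ξ)(f) = ξ(ψ(f))`. -/
def pullbackVec {B : Type u} [CommRing B] [Algebra ℝ B] (ψ : A →ₐ[ℝ] B) (ξ : B →ₗ[ℝ] ℝ) :
    A →ₗ[ℝ] ℝ := ξ ∘ₗ ψ.toLinearMap

/-- `ψ_*(g) = g'`: for all derivations `X, Y` of `B` and all `q ∈ |B|`,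
`g(ψ^*(X_q), ψ^*(Y_q)) = g'(X, Y)(q)`, the left side being evaluated in `T_{|ψ|(q)}A`. -/
def PushesForward {B : Type u} [CommRing B] [Algebra ℝ B] (ψ : A →ₐ[ℝ] B) (g : AlgMetric A)
    (g' : AlgMetric B) : Prop :=
  ∀ (X Y : Der B) (q : Points B), g.AtPoint (pointsMap ψ q) (pullbackVec ψ (evalDer q X))
    (pullbackVec ψ (evalDer q Y)) (q (g'.toEquiv X Y))

end Algebras

/-! ## The category of Einstein algebras -/

/-- Einstein algebras. -/
structure EA : Type (u + 1) where
  carrier : Type u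
  [commRing : CommRing carrier]
  [algebra : Algebra ℝ carrier]
  smooth : IsSmoothAlg 4 carrier
  metric : AlgMetric carrier
  lorentz : metric.IsLorentz

namespace EA

instance : CoeSort EA.{u} (Type u) := ⟨carrier⟩

attribute [instance] commRing algebra

/-- Einstein algebra homomorphisms. -/
@[ext] structure Hom (A B : EA.{u}) where
  toAlgHom : A →ₐ[ℝ] B
  pushes : PushesForward toAlgHom A.metric B.metric

instance : Category EA.{u} where
  Hom := Hom
  id A := ⟨AlgHom.id ℝ A, fun X Y _ => ⟨X, Y, rfl, rfl, rfl⟩⟩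
  comp {A B C} ψ χ := ⟨χ.toAlgHom.comp ψ.toAlgHom, fun X Y r => by
    obtain ⟨Z, Z', hZ, hZ', h⟩ := χ.pushes X Y r
    obtain ⟨W, W', hW, hW', h'⟩ := ψ.pushes Z Z' (pointsMap χ.toAlgHom r)
    refine ⟨W, W', ?_, ?_, ?_⟩
    · rw [hZ] at hW; exact hW
    · rw [hZ'] at hW'; exact hW'
    · rw [h] at h'; exact h'⟩

instance (A : EA.{u}) : ChartedSpace (E 4) (Points A) := A.smooth.chartedSpace

instance (A : EA.{u}) : IsManifold (𝓡 4) ∞ (Points A) := A.smooth.isManifold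

instance (A : EA.{u}) : SecondCountableTopology (Points A) := A.smooth.secondCountable

end EA

/-! ## The category of relativistic spacetimes -/

/-- Smooth Lorentzian metrics, of signature `(1, 3)`, on a 4-dimensional manifold `M`. -/
structure LorentzMetric (M : Type u) [TopologicalSpace M] [ChartedSpace (E 4) M]
    [IsManifold (𝓡 4) ∞ M] where
  form (x : M) : TangentSpace (𝓡 4) x →L[ℝ] TangentSpace (𝓡 4) x →L[ℝ] ℝ
  symm (x : M) (v w : TangentSpace (𝓡 4) x) : form x v w = form x w v
  contMDiff : ContMDiff (𝓡 4) ((𝓡 4).prod 𝓘(ℝ, E 4 →L[ℝ] E 4 →L[ℝ] ℝ)) ∞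
    (fun x => Bundle.TotalSpace.mk' (E 4 →L[ℝ] E 4 →L[ℝ] ℝ)
      (E := fun x : M => TangentSpace (𝓡 4) x →L[ℝ] TangentSpace (𝓡 4) x →L[ℝ] ℝ) x (form x))
  lorentz (x : M) : ∃ b : Module.Basis (Fin 4) ℝ (TangentSpace (𝓡 4) x),
    ∀ i j, form x (b i) (b j) = minkowski i j

/-- `φ : (M, g) → (N, h)` is smooth with `φ^* h = g`. -/
structure IsIsometry {M N : Type u} [TopologicalSpace M] [ChartedSpace (E 4) M]
    [IsManifold (𝓡 4) ∞ M] [TopologicalSpace N] [ChartedSpace (E 4) N] [IsManifold (𝓡 4) ∞ N]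
    (g : LorentzMetric M) (h : LorentzMetric N) (φ : M → N) : Prop where
  contMDiff : ContMDiff (𝓡 4) (𝓡 4) ∞ φ
  pullback : ∀ (x : M) (v w : TangentSpace (𝓡 4) x),
    h.form (φ x) (mfderiv (𝓡 4) (𝓡 4) φ x v) (mfderiv (𝓡 4) (𝓡 4) φ x w) = g.form x v w

/-- Relativistic spacetimes: smooth (Hausdorff, second countable) 4-manifolds, not necessarily
connected, with a smooth Lorentzian metric. -/
structure GR : Type (u + 1) where
  carrier : Type u
  [topology : TopologicalSpace carrier]
  [charted : ChartedSpace (E 4) carrier]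
  [manifold : IsManifold (𝓡 4) ∞ carrier]
  [t2 : T2Space carrier]
  [secondCountable : SecondCountableTopology carrier]
  metric : LorentzMetric carrier

namespace GR

instance : CoeSort GR.{u} (Type u) := ⟨carrier⟩

attribute [instance] topology charted manifold t2 secondCountable

/-- Isometries, not necessarily invertible. -/
@[ext] structure Hom (M N : GR.{u}) where
  toFun : M → N
  isometry : IsIsometry M.metric N.metric toFun

instance : Category GR.{u} where
  Hom := Hom
  id M := ⟨id, contMDiff_id, fun x v w => by simp [mfderiv_id]⟩
  comp {L M N} φ ψ := ⟨ψ.toFun ∘ φ.toFun, ψ.isometry.contMDiff.comp φ.isometry.contMDiff, by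
    intro x v w
    have h1 := (φ.isometry.contMDiff.mdifferentiable (by simp)) x
    have h2 := (ψ.isometry.contMDiff.mdifferentiable (by simp)) (φ.toFun x)
    rw [mfderiv_comp x h2 h1, ← φ.isometry.pullback, ← ψ.isometry.pullback]
    rfl⟩

end GR

/-! ## The translations `J` and `K` -/

/-- `φ̂ : C^∞(N) → C^∞(M)`, `φ̂(f) = f ∘ φ`. -/
def pullbackFn {n : ℕ} {M N : Type u} [TopologicalSpace M] [ChartedSpace (E n) M]
    [TopologicalSpace N] [ChartedSpace (E n) N] (φ : M → N)
    (hφ : ContMDiff (𝓡 n) (𝓡 n) ∞ φ) : SmoothFn n N →ₐ[ℝ] SmoothFn n M where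
  toFun f := ⟨f ∘ φ, f.contMDiff.comp hφ⟩
  map_one' := rfl
  map_mul' _ _ := rfl
  map_zero' := rfl
  map_add' _ _ := rfl
  commutes' _ := rfl

/-- The derivative `v(f)` of a real function `f` in the direction of a tangent vector `v` at `x`. -/
def dirDeriv {M : Type u} [TopologicalSpace M] [ChartedSpace (E 4) M] (f : M → ℝ) (x : M)
    (v : TangentSpace (𝓡 4) x) : ℝ :=
  mfderiv (𝓡 4) 𝓘(ℝ, ℝ) f x v

/-- `ĝ` is the metric on `C^∞(M)` induced by `g`: `ĝ(X̂, Ŷ)(x) = g(X_x, Y_x)`, where a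
derivation `X̂` corresponds to the vector field `X` with `X̂(f)(x) = X_x(f)`. -/
def IsInducedAlgMetric {M : Type u} [TopologicalSpace M] [ChartedSpace (E 4) M]
    [IsManifold (𝓡 4) ∞ M] (g : LorentzMetric M) (g' : AlgMetric (SmoothFn 4 M)) : Prop :=
  ∀ (X Y : Der (SmoothFn 4 M)) (x : M), ∃ v w : TangentSpace (𝓡 4) x,
    (∀ f : SmoothFn 4 M, X f x = dirDeriv f x v) ∧ (∀ f : SmoothFn 4 M, Y f x = dirDeriv f x w) ∧
    g'.toEquiv X Y x = g.form x v w

/-- `g` is the metric `|ĝ|` on `|A|` induced by the metric `ĝ` of `A`: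
`|ĝ|(X_p, Y_p) = ĝ(X̂, Ŷ)(p)`, where `f ∈ A` is identified with the function `q ↦ q f` on `|A|`
and `X̂(f)(p) = X_p(f)`. -/
def IsInducedMetric (A : EA.{u}) (g : LorentzMetric (Points A)) : Prop :=
  ∀ (p : Points A) (v w : TangentSpace (𝓡 4) p), ∃ X Y : Der A,
    (∀ f : A, p (X f) = dirDeriv (fun q : Points A => q f) p v) ∧
    (∀ f : A, p (Y f) = dirDeriv (fun q : Points A => q f) p w) ∧
    g.form p v w = p (A.metric.toEquiv X Y)

/-- The translation `J`, `(M, g) ↦ (C^∞(M), ĝ)` and `φ ↦ φ̂`: the metrics `ĝ`, with the facts that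
make it a contravariant functor from spacetimes to Einstein algebras. -/
structure TranslationJ where
  smooth (M : GR.{u}) : IsSmoothAlg 4 (SmoothFn 4 M)
  metric (M : GR.{u}) : AlgMetric (SmoothFn 4 M)
  metric_spec (M : GR.{u}) : IsInducedAlgMetric M.metric (metric M)
  lorentz (M : GR.{u}) : (metric M).IsLorentz
  pushes {M N : GR.{u}} (φ : M ⟶ N) :
    PushesForward (pullbackFn φ.toFun φ.isometry.contMDiff) (metric N) (metric M)

/-- `J` as a contravariant functor. -/
def TranslationJ.functor (J : TranslationJ.{u}) : GR.{u}ᵒᵖ ⥤ EA.{u} where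
  obj M := ⟨SmoothFn 4 M.unop, J.smooth M.unop, J.metric M.unop, J.lorentz M.unop⟩
  map φ := ⟨pullbackFn φ.unop.toFun φ.unop.isometry.contMDiff, J.pushes φ.unop⟩
  map_id _ := rfl
  map_comp _ _ := rfl

/-- The translation `K`, `(A, ĝ) ↦ (|A|, |ĝ|)` and `ψ ↦ |ψ|`: the metrics `|ĝ|`, with the facts
that make it a contravariant functor from Einstein algebras to spacetimes. -/
structure TranslationK where
  metric (A : EA.{u}) : LorentzMetric (Points A)
  metric_spec (A : EA.{u}) : IsInducedMetric A (metric A)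
  isometry {A B : EA.{u}} (ψ : A ⟶ B) :
    IsIsometry (metric B) (metric A) (pointsMap ψ.toAlgHom)

/-- `K` as a contravariant functor. -/
def TranslationK.functor (K : TranslationK.{u}) : EA.{u}ᵒᵖ ⥤ GR.{u} where
  obj A := ⟨Points A.unop, K.metric A.unop⟩
  map ψ := ⟨pointsMap ψ.unop.toAlgHom, K.isometry ψ.unop⟩
  map_id _ := rfl
  map_comp _ _ := rfl

/-- Two categories are dual if there are contravariant functors between them whose two composites
are naturally isomorphic to the identity functors. -/
def AreDual (C D : Type*) [Category C] [Category D] : Prop :=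
  ∃ (F : Cᵒᵖ ⥤ D) (G : Dᵒᵖ ⥤ C),
    Nonempty (𝟭 C ≅ F.rightOp ⋙ G) ∧ Nonempty (𝟭 D ≅ G.rightOp ⋙ F)

end

end EinsteinAlg

open EinsteinAlg

open scoped Topology
open Set Filter

/-! Two reconstruction facts carry the duality on underlying spaces and algebras. Every homomorphism
`C^∞(M) → ℝ` is an evaluation: otherwise a function with compact sublevel sets and finitely many
others combine into a nowhere vanishing, hence invertible, element of its kernel
(`pointEval_surjective`). Bump functions separate points and generate the topology, so `M` is
homeomorphic to `|C^∞(M)|`. Conversely `A → C^∞(|A|)` is injective because `A` is geometric, and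
surjective because a smooth function on `|A|` is, through the charts, locally an element of `A`, and
`A` is complete (`EA.toSmoothFn_bijective`).

For the metrics, fix an isomorphism `Φ : A ≃ C^∞(M)`. By Hadamard's lemma derivations at a point are
tangent vectors, so derivations of `A` are smooth vector fields, and an `A`-linear form on
derivations depends at each point only on the vector there (`dual_congr`). Hence a metric on `A` is
a field of bilinear forms on `M`. Conversely a Lorentzian metric gives a module isomorphism: it is
nondegenerate, and Cramer's rule shows that raising an index preserves smoothness
(`LorentzMetric.flat_bijective`).

`Compatible` records this correspondence, and `Compatible.pushesForward_iff` matches the two kinds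
of arrows. The identity `Φ` yields `J`, and `A ≃ C^∞(|A|)` yields `K`. The unit `η` then lies over
the identity map of `|A|`, and `θ` over the identity homomorphism of `C^∞(M)`, so both respect the
metrics at once. -/

namespace EinsteinAlg

noncomputable section

/-! ### Bump functions and the points of `C^∞(M)`. -/

section SmoothFunctions

variable {n : ℕ} {M : Type u} [TopologicalSpace M] [ChartedSpace (E n) M]

/-- Evaluation of smooth functions at a point of the manifold. -/
def pointEval (x : M) : Points (SmoothFn n M) :=
  show SmoothFn n M →ₐ[ℝ] ℝ from
    { ContMDiffMap.evalRingHom x with commutes' := fun _ => rfl }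

@[simp] theorem pointEval_apply (x : M) (f : SmoothFn n M) : pointEval x f = f x := rfl

@[simp] theorem SmoothFn.add_apply (f g : SmoothFn n M) (x : M) : (f + g) x = f x + g x := rfl

@[simp] theorem SmoothFn.mul_apply (f g : SmoothFn n M) (x : M) : (f * g) x = f x * g x := rfl

theorem SmoothFn.sum_apply {ι : Type*} (s : Finset ι) (f : ι → SmoothFn n M) (x : M) :
    (∑ i ∈ s, f i) x = ∑ i ∈ s, f i x :=
  map_sum (ContMDiffMap.evalRingHom (I := 𝓡 n) (n := ∞) (R := ℝ) x) f s

variable [IsManifold (𝓡 n) ∞ M] [T2Space M]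

theorem exists_bump {x : M} {U : Set M} (hU : U ∈ 𝓝 x) :
    ∃ b : SmoothFn n M, (∀ᶠ y in 𝓝 x, b y = 1) ∧ tsupport b ⊆ U := by
  obtain ⟨b, hb, -⟩ := (SmoothBumpFunction.nhds_basis_support (I := 𝓡 n) hU).mem_iff.1 hU
  exact ⟨⟨b, b.contMDiff⟩, b.eventuallyEq_one, hb⟩

theorem exists_smoothFn_eventuallyEq {x : M} {U : Set M} (hU : IsOpen U) (hx : x ∈ U) {f : M → ℝ}
    (hf : ContMDiffOn (𝓡 n) 𝓘(ℝ, ℝ) ∞ f U) : ∃ F : SmoothFn n M, ∀ᶠ y in 𝓝 x, F y = f y := by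
  obtain ⟨b, hb, hbU⟩ := exists_bump (n := n) (hU.mem_nhds hx)
  refine ⟨⟨fun y => b y * f y, contMDiff_of_tsupport fun y hy => ?_⟩, ?_⟩
  · have hyU : y ∈ U := hbU (tsupport_mul_subset_left hy)
    exact b.contMDiff.contMDiffAt.mul (hf.contMDiffAt (hU.mem_nhds hyU))
  · filter_upwards [hb] with y hy
    change b y * f y = f y
    rw [hy, one_mul]

/-- Near a given point the chart coordinates agree with globally defined smooth functions, so these
suffice to test smoothness. This is how maps into dual spaces are shown to be smooth. -/
theorem contMDiff_of_comp_smoothFn {m : ℕ} {N : Type*} [TopologicalSpace N] [ChartedSpace (E m) N]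
    {φ : N → M} (hφ : Continuous φ)
    (h : ∀ f : SmoothFn n M, ContMDiff (𝓡 m) 𝓘(ℝ, ℝ) ∞ (f ∘ φ)) :
    ContMDiff (𝓡 m) (𝓡 n) ∞ φ := by
  intro y
  rw [contMDiffAt_iff_target]
  refine ⟨hφ.continuousAt, ?_⟩
  have key : ∀ j : Fin n, ContMDiffAt (𝓡 m) 𝓘(ℝ, ℝ) ∞
      (fun z => extChartAt (𝓡 n) (φ y) (φ z) j) y := by
    intro j
    obtain ⟨c, hc⟩ := exists_smoothFn_eventuallyEq (n := n) (chartAt (E n) (φ y)).open_source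
      (mem_chart_source (E n) (φ y)) (f := fun z => extChartAt (𝓡 n) (φ y) z j)
      ((EuclideanSpace.proj (𝕜 := ℝ) j).contMDiff.comp_contMDiffOn contMDiffOn_extChartAt)
    refine (h c y).congr_of_eventuallyEq ?_
    filter_upwards [hφ.continuousAt.eventually hc] with z hz
    exact hz.symm
  exact (EuclideanSpace.equiv (Fin n) ℝ).symm.contDiff.contMDiff.contMDiffAt.comp y
    (contMDiffAt_pi_space.2 key)

theorem pointEval_injective : Function.Injective (pointEval (n := n) (M := M)) := by
  intro x y hxy
  by_contra hne
  obtain ⟨b, hb, hbU⟩ := exists_bump (n := n) (isOpen_compl_singleton.mem_nhds hne)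
  have h1 : b x = b y := DFunLike.congr_fun hxy b
  have h2 : b y = 0 := image_eq_zero_of_notMem_tsupport fun h => hbU h rfl
  rw [hb.self_of_nhds, h2] at h1
  exact one_ne_zero h1

variable [SecondCountableTopology M]

-- A partition of unity smooths the index function of a compact exhaustion from above. The result
-- bounds the region where a homomorphism could be concentrated, which replaces compactness of `M`.
variable (n M) in
theorem exists_smooth_exhaustion : ∃ h : SmoothFn n M, ∀ c : ℝ, IsCompact {x | h x ≤ c} := by
  have : LocallyCompactSpace M := ChartedSpace.locallyCompactSpace (E n) M
  let K : CompactExhaustion M := default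
  obtain ⟨h, hh⟩ := exists_contMDiffMap_forall_mem_convex_of_local_const (𝓡 n)
    (n := (⊤ : ℕ∞))
    (t := fun x : M => Ici (K.find x : ℝ)) (fun x => convex_Ici _) (fun x => by
      -- The index may jump up near `x`, but by at most one, since `x` is interior to the next
      -- compact set.
      refine ⟨K.find x + 1, ?_⟩
      filter_upwards [mem_interior_iff_mem_nhds.1
        (K.subset_interior_succ _ (K.mem_find x))] with y hy
      have := K.mem_iff_find_le.1 hy
      rw [mem_Ici]
      exact_mod_cast this)
  refine ⟨h, fun c => (K.isCompact ⌊c⌋₊).of_isClosed_subset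
    (isClosed_le h.contMDiff.continuous continuous_const) fun x hx => ?_⟩
  rw [K.mem_iff_find_le]
  exact Nat.le_floor ((hh x).trans hx)

/-- An element of the kernel of `χ` cannot be invertible, so it must vanish somewhere. If `χ` were
no evaluation, finitely many functions would already rule out every point of a compact sublevel set
of `h`, and `h` itself rules out the rest. -/
theorem pointEval_surjective : Function.Surjective (pointEval (n := n) (M := M)) := by
  intro χ
  by_contra! hne
  have hne' : ∀ x : M, ∃ f : SmoothFn n M, f x ≠ χ f := by
    intro x
    by_contra! h
    exact hne x (Points.ext h)
  choose f hf using hne'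
  obtain ⟨h, hh⟩ := exists_smooth_exhaustion n M
  obtain ⟨t, -, ht⟩ := (hh (χ h)).elim_nhds_subcover (fun x => {y | f x y ≠ χ (f x)})
    fun x _ => (isOpen_ne_fun (f x).contMDiff.continuous continuous_const).mem_nhds (hf x)
  -- A zero of this sum of squares satisfies `h y = χ h`, hence lies in the compact set, where one
  -- of the chosen `f x` contributes a positive term.
  let g : SmoothFn n M := (h - algebraMap ℝ _ (χ h)) ^ 2 +
    ∑ x ∈ t, (f x - algebraMap ℝ _ (χ (f x))) ^ 2
  have hg : χ g = 0 := by simp [g, AlgHomClass.commutes]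
  have hgx : ∀ y, g y = (h y - χ h) ^ 2 + ∑ x ∈ t, (f x y - χ (f x)) ^ 2 := by
    intro y
    rw [← pointEval_apply]
    simp only [g, map_add, map_sum, map_pow, map_sub]
    rfl
  have hpos : ∀ y, g y ≠ 0 := by
    intro y hy
    rw [hgx] at hy
    have h1 : (0 : ℝ) ≤ ∑ x ∈ t, (f x y - χ (f x)) ^ 2 := Finset.sum_nonneg fun _ _ => sq_nonneg _
    have h2 : (h y - χ h) ^ 2 = 0 := by nlinarith [sq_nonneg (h y - χ h)]
    have h3 : ∑ x ∈ t, (f x y - χ (f x)) ^ 2 = 0 := by linarith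
    have h4 : h y = χ h := sub_eq_zero.1 (pow_eq_zero_iff two_ne_zero |>.1 h2)
    obtain ⟨x, hx, hxy⟩ := mem_iUnion₂.1 (ht (show h y ≤ χ h from h4.le))
    have := (Finset.sum_eq_zero_iff_of_nonneg (fun _ _ => sq_nonneg _)).1 h3 x hx
    exact hxy (sub_eq_zero.1 (pow_eq_zero_iff two_ne_zero |>.1 this))
  let k : SmoothFn n M := ⟨fun y => (g y)⁻¹, g.contMDiff.inv₀ hpos⟩
  have hk : g * k = 1 := by
    ext y
    exact mul_inv_cancel₀ (hpos y)
  have := congrArg χ hk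
  rw [map_mul, hg, zero_mul, map_one] at this
  exact zero_ne_one this

variable (n M) in
/-- The points of `C^∞(M)` are the points of `M`. -/
def pointHomeo : M ≃ₜ Points (SmoothFn n M) :=
  (Equiv.ofBijective pointEval ⟨pointEval_injective,
    pointEval_surjective⟩).toHomeomorphOfContinuousOpen (Points.continuous_iff.2 fun f => f.contMDiff.continuous) <| by
    intro U hU
    rw [isOpen_iff_mem_nhds]
    rintro _ ⟨x, hx, rfl⟩
    obtain ⟨b, hb, hbU⟩ := exists_bump (n := n) (hU.mem_nhds hx)
    -- The nonvanishing set of a bump function is weakly open and lies inside the image of `U`.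
    have ho : IsOpen {p : Points (SmoothFn n M) | p b ≠ 0} :=
      isOpen_ne_fun (Points.continuous_apply b) continuous_const
    refine mem_of_superset (ho.mem_nhds ?_) ?_
    · change b x ≠ 0
      rw [hb.self_of_nhds]
      exact one_ne_zero
    · intro q hq
      obtain ⟨y, rfl⟩ := pointEval_surjective q
      exact ⟨y, hbU (subset_tsupport _ hq), rfl⟩

@[simp] theorem pointHomeo_apply (x : M) : pointHomeo n M x = pointEval x := rfl

@[simp] theorem pointHomeo_symm_pointEval (x : M) :
    (pointHomeo n M).symm (pointEval x) = x :=
  (pointHomeo n M).symm_apply_apply x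

theorem apply_pointHomeo_symm (p : Points (SmoothFn n M)) (f : SmoothFn n M) :
    f ((pointHomeo n M).symm p) = p f := by
  obtain ⟨x, rfl⟩ := pointEval_surjective p
  simp

end SmoothFunctions

/-! ### `C^∞(M)` is a smooth algebra. -/

section SmoothAlgebras

variable {n : ℕ} {M : Type u} [TopologicalSpace M] [ChartedSpace (E n) M]

theorem ContMDiff.of_mem_restriction {m : ℕ} {N : Type*} [TopologicalSpace N]
    [ChartedSpace (E m) N] {S : Set (Points (SmoothFn n M))}
    (f : restriction S) {φ : N → M} (hφ : ContMDiff (𝓡 m) (𝓡 n) ∞ φ)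
    (h : ∀ z, pointEval (φ z) ∈ S) :
    ContMDiff (𝓡 m) 𝓘(ℝ, ℝ) ∞ fun z => (f : S → ℝ) ⟨pointEval (φ z), h z⟩ := by
  intro z
  obtain ⟨O, hO, hz, a, ha⟩ := f.2 ⟨pointEval (φ z), h z⟩
  have hc : Continuous fun z => pointEval (n := n) (φ z) :=
    Points.continuous_iff.2 fun f => f.contMDiff.continuous.comp hφ.continuous
  refine ((a.contMDiff.comp hφ) z).congr_of_eventuallyEq ?_
  filter_upwards [(hO.preimage hc).mem_nhds hz] with y hy
  exact ha ⟨pointEval (φ y), h y⟩ hy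

variable [IsManifold (𝓡 n) ∞ M]

/-- Shrink a chart to a coordinate ball and stretch the ball onto all of `ℝⁿ` by a diffeomorphism,
since the definition of a smooth algebra asks for copies of `C^∞(ℝⁿ)`. -/
theorem exists_chart_target_univ (x : M) : ∃ e : OpenPartialHomeomorph M (E n),
    x ∈ e.source ∧ e.target = univ ∧ ContMDiffOn (𝓡 n) (𝓡 n) ∞ e e.source ∧
      ContMDiff (𝓡 n) (𝓡 n) ∞ e.symm := by
  let φ := chartAt (E n) x
  obtain ⟨r, hr, hball⟩ := Metric.mem_nhds_iff.1
    (φ.open_target.mem_nhds (φ.map_source (mem_chart_source (E n) x)))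
  let β := OpenPartialHomeomorph.univBall (φ x) r
  have hβt : β.target = Metric.ball (φ x) r := OpenPartialHomeomorph.univBall_target _ hr
  have hβs : β.source = univ := OpenPartialHomeomorph.univBall_source _ _
  have hβ : ∀ z, β z ∈ φ.target := fun z => hball (by
    rw [← hβt]; exact β.map_source (by rw [hβs]; trivial))
  have hβc : ContMDiff (𝓡 n) (𝓡 n) ∞ β := OpenPartialHomeomorph.contDiff_univBall.contMDiff
  have hβc' : ContMDiffOn (𝓡 n) (𝓡 n) ∞ β.symm (Metric.ball (φ x) r) :=
    OpenPartialHomeomorph.contDiffOn_univBall_symm.contMDiffOn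
  refine ⟨φ.trans β.symm, ?_, ?_, ?_, ?_⟩
  · simp [φ, hβt, hr]
  · simp only [OpenPartialHomeomorph.trans_target, OpenPartialHomeomorph.symm_target, hβs,
      OpenPartialHomeomorph.symm_symm, univ_inter]
    exact eq_univ_of_forall hβ
  · refine hβc'.comp ((contMDiffOn_chart (x := x)).mono fun y hy => hy.1) fun y hy => ?_
    have := hy.2
    simpa [hβt] using this
  · exact contMDiffOn_univ.1 <| (contMDiffOn_chart_symm (x := x)).comp hβc.contMDiffOn
      fun z _ => hβ z

variable [T2Space M] [SecondCountableTopology M]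

/-- The restriction of `C^∞(M)` to a coordinate ball is `C^∞(ℝⁿ)`. -/
def restrictionToModel (e : OpenPartialHomeomorph M (E n)) (ht : e.target = univ)
    (hs : ContMDiff (𝓡 n) (𝓡 n) ∞ e.symm) :
    restriction (pointHomeo n M '' e.source) →ₐ[ℝ] SmoothFn n (E n) where
  toFun f := ⟨fun z => f.1
    ⟨pointEval (e.symm z), mem_image_of_mem _ (e.map_target (ht ▸ mem_univ z))⟩,
    ContMDiff.of_mem_restriction f hs _⟩
  map_one' := rfl
  map_mul' _ _ := rfl
  map_zero' := rfl
  map_add' _ _ := rfl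
  commutes' _ := rfl

theorem restrictionToModel_bijective (e : OpenPartialHomeomorph M (E n)) (ht : e.target = univ)
    (he : ContMDiffOn (𝓡 n) (𝓡 n) ∞ e e.source) (hs : ContMDiff (𝓡 n) (𝓡 n) ∞ e.symm) :
    Function.Bijective (restrictionToModel e ht hs) := by
  constructor
  · intro f g hfg
    ext ⟨_, x, hx, rfl⟩
    have := DFunLike.congr_fun hfg (e x)
    change f.1 ⟨pointEval (e.symm (e x)), _⟩ =
      g.1 ⟨pointEval (e.symm (e x)), _⟩ at this
    simp only [e.left_inv hx] at this
    exact this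
  · intro F
    refine ⟨⟨fun p => F (e ((pointHomeo n M).symm p)), ?_⟩, ?_⟩
    · rintro ⟨_, x, hx, rfl⟩
      -- `F ∘ e` is smooth only on the source of `e`; membership in the restriction needs just a
      -- global function with the same germ at `x`.
      obtain ⟨a, ha⟩ := exists_smoothFn_eventuallyEq (n := n) e.open_source hx
        (F.contMDiff.comp_contMDiffOn he)
      obtain ⟨O, hO, hOo, hxO⟩ := eventually_nhds_iff.1 ha
      refine ⟨pointHomeo n M '' O, (pointHomeo n M).isOpenMap _ hOo, mem_image_of_mem _ hxO, a, ?_⟩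
      rintro ⟨_, _⟩ ⟨y, hy, rfl⟩
      simpa using (hO y hy).symm
    · ext z
      change F (e ((pointHomeo n M).symm (pointEval (e.symm z)))) = F z
      rw [pointHomeo_symm_pointEval, e.right_inv (ht ▸ mem_univ z)]

variable (n M) in
theorem isSmoothAlg_smoothFn : IsSmoothAlg n (SmoothFn n M) where
  geometric f hf := by
    ext x
    exact hf (pointEval x)
  complete f := by
    refine ⟨⟨fun x => f.1 ⟨pointEval x, trivial⟩,
      ContMDiff.of_mem_restriction f contMDiff_id fun _ => trivial⟩, ?_⟩
    ext ⟨p, hp⟩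
    obtain ⟨x, rfl⟩ := pointEval_surjective p
    rfl
  cover := by
    choose e hxe ht he hs using exists_chart_target_univ (n := n) (M := M)
    -- Second countability supplies the countable subcover.
    obtain ⟨s, hsc, hcov⟩ := TopologicalSpace.countable_cover_nhds
      fun x => (e x).open_source.mem_nhds (hxe x)
    refine ⟨(fun x => pointHomeo n M '' (e x).source) '' s, hsc.image _, ?_, ?_⟩
    · refine eq_univ_of_forall fun p => ?_
      obtain ⟨y, rfl⟩ := pointEval_surjective p
      obtain ⟨x, hx, hy⟩ := mem_iUnion₂.1 (hcov.symm ▸ mem_univ y : y ∈ ⋃ x ∈ s, (e x).source)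
      exact ⟨_, mem_image_of_mem _ hx, mem_image_of_mem _ hy⟩
    · rintro _ ⟨x, -, rfl⟩
      exact ⟨(pointHomeo n M).isOpenMap _ (e x).open_source,
        ⟨AlgEquiv.ofBijective _ (restrictionToModel_bijective (e x) (ht x) (he x) (hs x))⟩⟩

end SmoothAlgebras

/-! ### The isomorphism of `A` with `C^∞(|A|)`. -/

section EinsteinAlgebras

variable (A : EA.{u})

theorem EA.mem_chartAtlas_iff {e : OpenPartialHomeomorph (Points A) (E 4)} :
    e ∈ atlas (E 4) (Points A) ↔ e ∈ chartAtlas 4 A := Iff.rfl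

theorem EA.contMDiff_apply (f : A) :
    ContMDiff (𝓡 4) 𝓘(ℝ, ℝ) ∞ fun p : Points A => p f := by
  intro p
  obtain ⟨U, hU, i, he⟩ := (EA.mem_chartAtlas_iff A).1 (chart_mem_atlas (E 4) p)
  have hp : p ∈ (chart hU i).source := he ▸ mem_chart_source (E 4) p
  have hm : chart hU i ∈ IsManifold.maximalAtlas (𝓡 4) ∞ (Points A) :=
    he ▸ IsManifold.chart_mem_maximalAtlas p
  have h1 : ContMDiffAt (𝓡 4) (𝓡 4) ∞ (chart hU i) p := contMDiffAt_of_mem_maximalAtlas hm hp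
  refine (((i (restrictHom U f)).contMDiff _).comp p h1).congr_of_eventuallyEq ?_
  filter_upwards [hU.mem_nhds hp] with q hq
  have h2 : (chart hU i).symm (chart hU i q) = q := (chart hU i).left_inv hq
  have h3 : (chart hU i).symm (chart hU i q) f = i (restrictHom U f) (chart hU i q) := rfl
  rw [Function.comp_apply, ← h3, h2]

/-- The homomorphism `A → C^∞(|A|)`, `f ↦ (p ↦ p f)`. -/
def EA.toSmoothFn : A →ₐ[ℝ] SmoothFn 4 (Points A) where
  toFun f := ⟨fun p => p f, EA.contMDiff_apply A f⟩
  map_one' := by ext p; exact map_one p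
  map_mul' a b := by ext p; exact map_mul p a b
  map_zero' := by ext p; exact map_zero p
  map_add' a b := by ext p; exact map_add p a b
  commutes' r := by ext p; exact AlgHomClass.commutes p r

/-- Injectivity is geometricity. For surjectivity, `F` read in a chart is an element of `C^∞(ℝ⁴) ≅
A_{|U}`, so `F` is locally given by elements of `A`, and completeness glues them. -/
theorem EA.toSmoothFn_bijective : Function.Bijective (EA.toSmoothFn A) := by
  constructor
  · rw [injective_iff_map_eq_zero]
    intro f hf
    exact A.smooth.geometric f fun p => DFunLike.congr_fun hf p
  · intro F
    have hF : (fun p : (univ : Set (Points A)) => F p) ∈ restriction (A := A) univ := by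
      rintro ⟨p, -⟩
      obtain ⟨U, hU, i, he⟩ := (EA.mem_chartAtlas_iff A).1 (chart_mem_atlas (E 4) p)
      have hp : p ∈ U := by
        have : p ∈ (chart hU i).source := he ▸ mem_chart_source (E 4) p
        exact this
      have hm : chart hU i ∈ IsManifold.maximalAtlas (𝓡 4) ∞ (Points A) :=
        he ▸ IsManifold.chart_mem_maximalAtlas p
      have h1 : ContMDiff (𝓡 4) (𝓡 4) ∞ (chart hU i).symm :=
        contMDiffOn_univ.1 (contMDiffOn_symm_of_mem_maximalAtlas hm)
      let G : SmoothFn 4 (E 4) := ⟨F ∘ (chart hU i).symm, F.contMDiff.comp h1⟩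
      obtain ⟨O, hO, hpO, a, ha⟩ := (i.symm G).2 ⟨p, hp⟩
      refine ⟨O ∩ U, hO.inter hU, ⟨hpO, hp⟩, a, ?_⟩
      rintro ⟨q, _⟩ ⟨hq, hqU⟩
      have h2 := ha ⟨q, hqU⟩ hq
      rw [chartPoint_spec] at h2
      have h3 : G (chartPoint i ⟨q, hqU⟩) = F q :=
        congrArg F (chartInv_chartPoint i ⟨q, hqU⟩)
      exact h3.symm.trans h2
    obtain ⟨f, hf⟩ := A.smooth.complete ⟨_, hF⟩
    refine ⟨f, ?_⟩
    ext p
    exact congrFun (congrArg Subtype.val hf) ⟨p, trivial⟩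

/-- The isomorphism `A ≃ C^∞(|A|)`, `f ↦ (p ↦ p f)`. -/
def EA.equivSmoothFn : A ≃ₐ[ℝ] SmoothFn 4 (Points A) :=
  AlgEquiv.ofBijective (EA.toSmoothFn A) (EA.toSmoothFn_bijective A)

end EinsteinAlgebras

/-! ### Hadamard's lemma on vector spaces and on manifolds. -/

section Hadamard

/-- The integral is the value at `1` of the convolution of the indicator of `(0, 1]` with `s ↦ β s •
h (p, 1 - s)`, so smoothness of convolutions with parameters applies. -/
theorem contDiff_integral_zero_one {P F : Type*} [NormedAddCommGroup P] [NormedSpace ℝ P]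
    [NormedAddCommGroup F] [NormedSpace ℝ F] {h : P × ℝ → F} (hh : ContDiff ℝ ∞ h) :
    ContDiff ℝ ∞ fun p => ∫ t in (0 : ℝ)..1, h (p, t) := by
  -- The cutoff provides compact support without changing the integral: it equals `1` on `[-2, 2]`,
  -- which contains `1 - t` for every `t` in `(0, 1]`.
  let β : ContDiffBump (0 : ℝ) := ⟨2, 3, by norm_num, by norm_num⟩
  have key := MeasureTheory.contDiffOn_convolution_right_with_param_comp (μ := MeasureTheory.volume)
    (n := (⊤ : ℕ∞)) (ContinuousLinearMap.lsmul ℝ ℝ : ℝ →L[ℝ] F →L[ℝ] F)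
    (s := (univ : Set P)) (v := fun _ => (1 : ℝ)) contDiffOn_const
    (f := indicator (Ioc 0 1) fun _ => (1 : ℝ)) (g := fun p s => β s • h (p, 1 - s))
    (k := Metric.closedBall 0 3) isOpen_univ (isCompact_closedBall _ _)
    (fun p s _ hs => by
      rw [β.zero_of_le_dist (not_le.1 (mt Metric.mem_closedBall.2 hs)).le, zero_smul])
    (MeasureTheory.Integrable.locallyIntegrable
      ((MeasureTheory.integrable_indicator_iff measurableSet_Ioc).2 (by simp)))
    (ContDiff.contDiffOn ((β.contDiff.comp contDiff_snd).smul
      (hh.comp (contDiff_fst.prodMk (contDiff_const.sub contDiff_snd)))))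
  refine contDiffOn_univ.1 (key.congr fun p _ => ?_)
  rw [MeasureTheory.convolution_def, intervalIntegral.integral_of_le zero_le_one,
    ← MeasureTheory.integral_indicator measurableSet_Ioc]
  congr 1
  ext t
  by_cases ht : t ∈ Ioc (0 : ℝ) 1
  · have : β (1 - t) = 1 := β.one_of_mem_closedBall (by
      rw [mem_closedBall_zero_iff, Real.norm_eq_abs, abs_le]
      constructor <;> simp only [β] <;> linarith [ht.1, ht.2])
    simp [ht, this]
  · simp [ht]

/-- Hadamard's lemma. -/
theorem exists_hadamard {V : Type*} [NormedAddCommGroup V] [NormedSpace ℝ V] {F : V → ℝ}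
    (hF : ContDiff ℝ ∞ F) (c : V) :
    ∃ G : V → V →L[ℝ] ℝ, ContDiff ℝ ∞ G ∧ ∀ y, F y = F c + G y (y - c) := by
  have hd : ContDiff ℝ ∞ (fderiv ℝ F) := hF.fderiv_right (by simp)
  have hline : ContDiff ℝ ∞ fun q : V × ℝ => c + q.2 • (q.1 - c) :=
    contDiff_const.add (contDiff_snd.smul (contDiff_fst.sub contDiff_const))
  -- `G y` is the average of the derivative of `F` along the segment from `c` to `y`.
  refine ⟨_, contDiff_integral_zero_one (hd.comp hline), fun y => ?_⟩
  have hcont : Continuous fun t : ℝ => fderiv ℝ F (c + t • (y - c)) :=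
    hd.continuous.comp (by fun_prop)
  have h1 : (∫ t in (0 : ℝ)..1, fderiv ℝ F (c + t • (y - c))) (y - c) =
      ∫ t in (0 : ℝ)..1, fderiv ℝ F (c + t • (y - c)) (y - c) :=
    ContinuousLinearMap.intervalIntegral_apply (hcont.intervalIntegrable _ _) _
  have h2 : ∫ t in (0 : ℝ)..1, fderiv ℝ F (c + t • (y - c)) (y - c) =
      F (c + (1 : ℝ) • (y - c)) - F (c + (0 : ℝ) • (y - c)) := by
    refine intervalIntegral.integral_eq_sub_of_hasDerivAt
      (f := fun t : ℝ => F (c + t • (y - c))) (fun t _ => ?_)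
      ((hcont.clm_apply continuous_const).intervalIntegrable _ _)
    have hl : HasDerivAt (fun t : ℝ => c + t • (y - c)) (y - c) t := by
      simpa using ((hasDerivAt_id t).smul_const (y - c)).const_add c
    exact ((hF.differentiable (by simp)) _).hasFDerivAt.comp_hasDerivAt t hl
  simp only [Function.comp_apply]
  rw [h1, h2]
  simp

variable {n : ℕ} {M : Type u} [TopologicalSpace M] [ChartedSpace (E n) M]
  [IsManifold (𝓡 n) ∞ M] [T2Space M]

theorem exists_coord (x : M) (j : Fin n) :
    ∃ c : SmoothFn n M, ∀ᶠ y in 𝓝 x, c y = extChartAt (𝓡 n) x y j :=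
  exists_smoothFn_eventuallyEq (chartAt (E n) x).open_source (mem_chart_source (E n) x)
    ((EuclideanSpace.proj (𝕜 := ℝ) j).contMDiff.comp_contMDiffOn contMDiffOn_extChartAt)

theorem SmoothFn.exists_hadamard (f : SmoothFn n M) (x : M) {c : Fin n → SmoothFn n M}
    (hc : ∀ j, ∀ᶠ y in 𝓝 x, c j y = extChartAt (𝓡 n) x y j) :
    ∃ g : Fin n → SmoothFn n M,
      ∀ᶠ y in 𝓝 x, f y = f x + ∑ j, (c j y - c j x) * g j y := by
  let φ := extChartAt (𝓡 n) x
  have hopen : IsOpen φ.target := isOpen_extChartAt_target x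
  -- The local representative of `f` is replaced by a function on all of `ℝⁿ` with the same germ, so
  -- segments need not stay in the chart's image.
  obtain ⟨F, hF⟩ := exists_smoothFn_eventuallyEq (n := n) (M := E n) hopen
    (mem_extChartAt_target (I := 𝓡 n) x)
    (f.contMDiff.comp_contMDiffOn (contMDiffOn_extChartAt_symm x))
  obtain ⟨G, hG, hGF⟩ := EinsteinAlg.exists_hadamard
    (contMDiff_iff_contDiff.1 F.contMDiff) (φ x)
  have hGj : ∀ j : Fin n, ∃ g : SmoothFn n M, ∀ᶠ y in 𝓝 x,
      g y = G (φ y) (EuclideanSpace.single j 1) := by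
    intro j
    exact exists_smoothFn_eventuallyEq (chartAt (E n) x).open_source (mem_chart_source (E n) x)
      ((hG.clm_apply contDiff_const).contMDiff.comp_contMDiffOn contMDiffOn_extChartAt)
  choose g hg using hGj
  refine ⟨g, ?_⟩
  have hFx : F (φ x) = f x := by
    rw [hF.self_of_nhds, Function.comp_apply, extChartAt_to_inv]
  filter_upwards [eventually_all.2 hc, eventually_all.2 hg,
    (continuousAt_extChartAt (I := 𝓡 n) x).eventually hF,
    extChartAt_source_mem_nhds (I := 𝓡 n) x] with y hcy hgy hFy hy
  have h1 : F (φ y) = f y := by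
    rw [hFy, Function.comp_apply, (extChartAt (𝓡 n) x).left_inv hy]
  rw [← h1, hGF, hFx]
  congr 1
  have h2 : φ y - φ x = ∑ j, (c j y - c j x) • EuclideanSpace.single j (1 : ℝ) := by
    ext k
    simp [hcy, (hc _).self_of_nhds, Finset.sum_apply, Pi.single_apply, φ]
  rw [h2, map_sum]
  refine Finset.sum_congr rfl fun j _ => ?_
  rw [map_smul, smul_eq_mul, hgy]

end Hadamard

/-! ### Derivations at a point are local and determined by coordinates. -/

section PointDerivations

variable {n : ℕ} {M : Type u} [TopologicalSpace M] [ChartedSpace (E n) M]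

/-- The Leibniz rule at a point. -/
def IsDerivationAt (x : M) (δ : SmoothFn n M →ₗ[ℝ] ℝ) : Prop :=
  ∀ f g : SmoothFn n M, δ (f * g) = f x * δ g + g x * δ f

theorem IsDerivationAt.map_algebraMap {x : M} {δ : SmoothFn n M →ₗ[ℝ] ℝ}
    (h : IsDerivationAt x δ) (r : ℝ) : δ (algebraMap ℝ _ r) = 0 := by
  have h1 := h 1 1
  have h2 : (1 : SmoothFn n M) x = 1 := rfl
  rw [mul_one, h2] at h1
  rw [Algebra.algebraMap_eq_smul_one, map_smul]
  have : δ 1 = 0 := by linarith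
  rw [this, smul_zero]

variable [IsManifold (𝓡 n) ∞ M] [T2Space M]

/-- A bump function `b` supported where `f = g` gives `b * (f - g) = 0`; the Leibniz rule with `b x
= 1` then kills `δ (f - g)`. -/
theorem IsDerivationAt.congr {x : M} {δ : SmoothFn n M →ₗ[ℝ] ℝ}
    (h : IsDerivationAt x δ) {f g : SmoothFn n M} (hfg : ∀ᶠ y in 𝓝 x, f y = g y) :
    δ f = δ g := by
  obtain ⟨b, hb, hbU⟩ := exists_bump (n := n) hfg
  have h0 : b * (f - g) = 0 := by
    ext y
    change b y * (f y - g y) = 0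
    by_cases hy : y ∈ tsupport b
    · rw [show f y = g y from hbU hy, sub_self, mul_zero]
    · rw [image_eq_zero_of_notMem_tsupport hy, zero_mul]
  have h1 := h b (f - g)
  have h2 : (f - g) x = 0 := sub_eq_zero.2 hfg.self_of_nhds
  rw [h0, map_zero, hb.self_of_nhds, h2, map_sub] at h1
  linarith

/-- Each factor `c j - c j x` vanishes at `x`, so only one Leibniz term per product survives.
Combined with Hadamard's lemma, a derivation at `x` is fixed by its values on coordinate functions.
-/
theorem IsDerivationAt.eq_sum {x : M} {δ : SmoothFn n M →ₗ[ℝ] ℝ}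
    (h : IsDerivationAt x δ) {f : SmoothFn n M} {c g : Fin n → SmoothFn n M}
    (hf : ∀ᶠ y in 𝓝 x, f y = f x + ∑ j, (c j y - c j x) * g j y) :
    δ f = ∑ j, g j x * δ (c j) := by
  have h1 : δ f = δ (algebraMap ℝ _ (f x) + ∑ j, (c j - algebraMap ℝ _ (c j x)) * g j) := by
    refine h.congr (hf.mono fun y hy => ?_)
    rw [hy, SmoothFn.add_apply, SmoothFn.sum_apply]
    rfl
  rw [h1, map_add, h.map_algebraMap, zero_add, map_sum]
  refine Finset.sum_congr rfl fun j _ => ?_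
  rw [h, map_sub, h.map_algebraMap]
  have : (c j - algebraMap ℝ _ (c j x)) x = 0 := sub_self (c j x)
  rw [this]
  ring

end PointDerivations

/-! ### Tangent vectors as derivations at a point. -/

section DirectionalDerivatives

variable {M : Type u} [TopologicalSpace M] [ChartedSpace (E 4) M] {x : M}

instance (x : M) : FiniteDimensional ℝ (TangentSpace (𝓡 4) x) :=
  inferInstanceAs (FiniteDimensional ℝ (E 4))

instance (x : M) : T2Space (TangentSpace (𝓡 4) x) :=
  inferInstanceAs (T2Space (E 4))

theorem dirDeriv_add_right (f : M → ℝ) (v w : TangentSpace (𝓡 4) x) :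
    dirDeriv f x (v + w) = dirDeriv f x v + dirDeriv f x w :=
  map_add (mfderiv (𝓡 4) 𝓘(ℝ, ℝ) f x) v w

theorem dirDeriv_smul_right (f : M → ℝ) (r : ℝ) (v : TangentSpace (𝓡 4) x) :
    dirDeriv f x (r • v) = r * dirDeriv f x v :=
  map_smul (mfderiv (𝓡 4) 𝓘(ℝ, ℝ) f x) r v

theorem dirDeriv_sum_right {ι : Type*} (s : Finset ι) (f : M → ℝ)
    (v : ι → TangentSpace (𝓡 4) x) :
    dirDeriv f x (∑ i ∈ s, v i) = ∑ i ∈ s, dirDeriv f x (v i) :=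
  map_sum (mfderiv (𝓡 4) 𝓘(ℝ, ℝ) f x) v s

theorem dirDeriv_congr {f g : M → ℝ} (h : ∀ᶠ y in 𝓝 x, f y = g y)
    (v : TangentSpace (𝓡 4) x) : dirDeriv f x v = dirDeriv g x v := by
  have h' : mfderiv (𝓡 4) 𝓘(ℝ, ℝ) f x = (mfderiv (𝓡 4) 𝓘(ℝ, ℝ) g x : E 4 →L[ℝ] ℝ) :=
    Filter.EventuallyEq.mfderiv_eq h
  exact DFunLike.congr_fun h' v

theorem dirDeriv_comp {N : Type u} [TopologicalSpace N] [ChartedSpace (E 4) N] (f : SmoothFn 4 M)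
    {φ : N → M} (hφ : ContMDiff (𝓡 4) (𝓡 4) ∞ φ) (y : N) (v : TangentSpace (𝓡 4) y) :
    dirDeriv (f ∘ φ) y v = dirDeriv f (φ y) (mfderiv (𝓡 4) (𝓡 4) φ y v) :=
  DFunLike.congr_fun (mfderiv_comp y (f.contMDiff.mdifferentiable (by simp) (φ y))
    (hφ.mdifferentiable (by simp) y)) v

/-- A tangent vector as a linear functional on smooth functions. -/
def dirDerivHom (x : M) (v : TangentSpace (𝓡 4) x) : SmoothFn 4 M →ₗ[ℝ] ℝ where
  toFun f := dirDeriv f x v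
  map_add' f g := DFunLike.congr_fun (mfderiv_add (f.contMDiff.mdifferentiable (by simp) x)
    (g.contMDiff.mdifferentiable (by simp) x)) v
  map_smul' r f := DFunLike.congr_fun (const_smul_mfderiv
    (f.contMDiff.mdifferentiable (by simp) x) r) v

@[simp] theorem dirDerivHom_apply (v : TangentSpace (𝓡 4) x) (f : SmoothFn 4 M) :
    dirDerivHom x v f = dirDeriv f x v := rfl

theorem isDerivationAt_dirDerivHom (v : TangentSpace (𝓡 4) x) :
    IsDerivationAt x (dirDerivHom x v) := fun f g =>
  DFunLike.congr_fun (HasMFDerivAt.mul (f.contMDiff.mdifferentiable (by simp) x).hasMFDerivAt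
    (g.contMDiff.mdifferentiable (by simp) x).hasMFDerivAt).mfderiv v

end DirectionalDerivatives

/-! ### Vector fields and coordinate frames cut off to global objects. -/

section Frames

/-- Smooth vector fields. -/
abbrev VField (M : Type u) [TopologicalSpace M] [ChartedSpace (E 4) M]
    [IsManifold (𝓡 4) ∞ M] : Type u :=
  Cₛ^∞⟮𝓡 4; E 4, (fun x : M => TangentSpace (𝓡 4) x)⟯

variable {M : Type u} [TopologicalSpace M] [ChartedSpace (E 4) M] [IsManifold (𝓡 4) ∞ M]

/-- Links the components of a vector in the tangent bundle trivialization with derivatives of chart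
coordinates. -/
theorem dirDeriv_extChartAt {x y : M} (hy : y ∈ (chartAt (E 4) x).source)
    (v : TangentSpace (𝓡 4) y) (j : Fin 4) :
    dirDeriv (fun z => extChartAt (𝓡 4) x z j) y v =
      (trivializationAt (E 4) (TangentSpace (𝓡 4)) x).continuousLinearMapAt ℝ y v j := by
  rw [TangentBundle.continuousLinearMapAt_trivializationAt hy]
  have h1 : MDifferentiableAt (𝓡 4) (𝓡 4) (extChartAt (𝓡 4) x) y :=
    mdifferentiableAt_extChartAt hy
  have h2 : MDifferentiableAt (𝓡 4) 𝓘(ℝ, ℝ) (EuclideanSpace.proj (𝕜 := ℝ) j : E 4 →L[ℝ] ℝ)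
      (extChartAt (𝓡 4) x y) := ContinuousLinearMap.mdifferentiableAt _
  have h3 := DFunLike.congr_fun (mfderiv_comp y h2 h1) v
  rw [ContinuousLinearMap.mfderiv_eq] at h3
  exact h3

theorem contMDiff_dirDeriv (f : SmoothFn 4 M) (V : VField M) :
    ContMDiff (𝓡 4) 𝓘(ℝ, ℝ) ∞ fun x => dirDeriv f x (V x) :=
  (contMDiff_snd_tangentBundle_modelSpace ℝ 𝓘(ℝ, ℝ)).comp
    ((f.contMDiff.contMDiff_tangentMap (m := ∞) (by simp)).comp V.contMDiff)

/-- The derivative of a smooth function along a vector field. -/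
def fieldDeriv (V : VField M) (f : SmoothFn 4 M) : SmoothFn 4 M :=
  ⟨fun x => dirDeriv f x (V x), contMDiff_dirDeriv f V⟩

variable [T2Space M]

/-- Coordinate functions and coordinate vector fields of a chart, extended to the manifold. -/
structure CoordFrame (x : M) where
  fn : Fin 4 → SmoothFn 4 M
  field : Fin 4 → VField M
  fn_eq (j : Fin 4) : ∀ᶠ y in 𝓝 x, fn j y = extChartAt (𝓡 4) x y j
  eq_sum : ∀ᶠ y in 𝓝 x, ∀ v : TangentSpace (𝓡 4) y,
    v = ∑ j, dirDeriv (fn j) y v • field j y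
  field_eq : ∀ᶠ y in 𝓝 x, ∀ i, field i y =
    (trivializationAt (E 4) (TangentSpace (𝓡 4)) x).symm y (EuclideanSpace.single i 1)
  dual : ∀ᶠ y in 𝓝 x, ∀ i j, dirDeriv (fn j) y (field i y) = if i = j then 1 else 0

theorem exists_coordFrame (x : M) : Nonempty (CoordFrame x) := by
  choose c hc using exists_coord (n := 4) x
  let t := trivializationAt (E 4) (TangentSpace (𝓡 4) : M → Type) x
  let B := (EuclideanSpace.basisFun (Fin 4) ℝ).toBasis
  have hxt : x ∈ t.baseSet := FiberBundle.mem_baseSet_trivializationAt' x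
  obtain ⟨b, hb, hbt⟩ := exists_bump (n := 4) (t.open_baseSet.mem_nhds hxt)
  let X : Fin 4 → VField M := fun j => ⟨(b : M → ℝ) • t.localFrame B j,
    ContMDiffOn.smul_section_of_tsupport b.contMDiff.contMDiffOn t.open_baseSet hbt
      (t.contMDiffOn_localFrame_baseSet ∞ B j)⟩
  have hX : ∀ᶠ y in 𝓝 x, ∀ j, X j y = t.symm y (EuclideanSpace.single j 1) := by
    filter_upwards [hb, t.open_baseSet.mem_nhds hxt] with y hy hyt j
    change b y • t.localFrame B j y = _
    rw [hy, one_smul, t.localFrame_apply_of_mem_baseSet B hyt, Bundle.Trivialization.basisAt,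
      Module.Basis.map_apply, OrthonormalBasis.coe_toBasis, EuclideanSpace.basisFun_apply]
    rfl
  have hv : ∀ j, ∀ᶠ y in 𝓝 x, ∀ v : TangentSpace (𝓡 4) y,
      dirDeriv (c j) y v = t.continuousLinearMapAt ℝ y v j := by
    intro j
    filter_upwards [(hc j).eventually_nhds,
      (chartAt (E 4) x).open_source.mem_nhds (mem_chart_source (E 4) x)] with y hy hys v
    rw [dirDeriv_congr hy, dirDeriv_extChartAt hys]
  refine ⟨c, X, hc, ?_, hX, ?_⟩
  · filter_upwards [hX, eventually_all.2 hv,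
      t.open_baseSet.mem_nhds hxt] with y hXy hvy hyt v
    have h1 : ∑ j, dirDeriv (c j) y v • X j y =
        t.symmL ℝ y (∑ j, t.continuousLinearMapAt ℝ y v j • EuclideanSpace.single j (1 : ℝ)) := by
      rw [map_sum]
      refine Finset.sum_congr rfl fun j _ => ?_
      rw [hvy, hXy, map_smul, t.symmL_apply hyt]
    have h2 : ∑ j, t.continuousLinearMapAt ℝ y v j • EuclideanSpace.single j (1 : ℝ) =
        t.continuousLinearMapAt ℝ y v := by
      ext k
      simp [Pi.single_apply]
    rw [h1, h2]
    exact (t.symmL_continuousLinearMapAt hyt v).symm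
  · filter_upwards [hX, eventually_all.2 hv,
      t.open_baseSet.mem_nhds hxt] with y hXy hvy hyt i j
    rw [hvy, hXy]
    have h1 : t.continuousLinearMapAt ℝ y (t.symm y (EuclideanSpace.single i 1)) =
      EuclideanSpace.single i 1 := by
      rw [← t.symmL_apply (R := ℝ) hyt]
      exact t.continuousLinearMapAt_symmL hyt _
    rw [h1]
    simp [eq_comm]

end Frames

/-! ### Points of an algebra identified with `C^∞(M)`. -/

section PointAt

variable {M : Type u} [TopologicalSpace M] [ChartedSpace (E 4) M]
  {A : Type u} [CommRing A] [Algebra ℝ A] (Φ : A ≃ₐ[ℝ] SmoothFn 4 M)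

/-- The point of `A` corresponding to `x`. -/
def pointAt (x : M) : Points A := pointsMap Φ.toAlgHom (pointEval x)

@[simp] theorem pointAt_apply (x : M) (f : A) : pointAt Φ x f = Φ f x := rfl

end PointAt

/-! ### Derivations as vector fields, and tensoriality of linear forms on them. -/

section Derivations

variable {M : Type u} [TopologicalSpace M] [ChartedSpace (E 4) M] [IsManifold (𝓡 4) ∞ M]
  [T2Space M]

/-- The vector with components `δ (F.fn j)` acts on coordinates as `δ` does, and Hadamard's lemma
extends the agreement to every `f`. -/
theorem IsDerivationAt.exists_vec {x : M} {δ : SmoothFn 4 M →ₗ[ℝ] ℝ} (h : IsDerivationAt x δ) :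
    ∃ v : TangentSpace (𝓡 4) x, ∀ f, δ f = dirDeriv f x v := by
  obtain ⟨F⟩ := exists_coordFrame x
  refine ⟨∑ j, δ (F.fn j) • F.field j x, fun f => ?_⟩
  obtain ⟨g, hg⟩ := f.exists_hadamard x F.fn_eq
  rw [h.eq_sum hg, ← dirDerivHom_apply, (isDerivationAt_dirDerivHom _).eq_sum hg]
  refine Finset.sum_congr rfl fun j _ => ?_
  rw [dirDerivHom_apply, dirDeriv_sum_right]
  simp [dirDeriv_smul_right, F.dual.self_of_nhds]

theorem vec_ext {x : M} {v w : TangentSpace (𝓡 4) x}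
    (h : ∀ f : SmoothFn 4 M, dirDeriv f x v = dirDeriv f x w) : v = w := by
  obtain ⟨F⟩ := exists_coordFrame x
  rw [F.eq_sum.self_of_nhds v, F.eq_sum.self_of_nhds w]
  simp only [h]

theorem exists_field (x : M) (v : TangentSpace (𝓡 4) x) : ∃ V : VField M, V x = v := by
  obtain ⟨F⟩ := exists_coordFrame x
  refine ⟨∑ j, dirDeriv (F.fn j) x v • F.field j, ?_⟩
  conv_rhs => rw [F.eq_sum.self_of_nhds v]
  have h : ∀ s : Finset (Fin 4), (∑ j ∈ s, dirDeriv (F.fn j) x v • F.field j : VField M) x =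
      ∑ j ∈ s, dirDeriv (F.fn j) x v • F.field j x := by
    intro s
    induction s using Finset.induction_on with
    | empty => rfl
    | insert a s ha ih =>
      rw [Finset.sum_insert ha, Finset.sum_insert ha, ← ih]
      rfl
  exact h _

variable {A : Type u} [CommRing A] [Algebra ℝ A] (Φ : A ≃ₐ[ℝ] SmoothFn 4 M)

theorem exists_derVec (X : Der A) (x : M) :
    ∃ v : TangentSpace (𝓡 4) x, ∀ f : A, Φ (X f) x = dirDeriv (Φ f) x v := by
  let δ : SmoothFn 4 M →ₗ[ℝ] ℝ :=
    { toFun f := Φ (X (Φ.symm f)) x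
      map_add' f g := by simp
      map_smul' r f := by simp }
  have hδ : IsDerivationAt x δ := fun f g => by
    simp [δ, Derivation.leibniz]
  obtain ⟨v, hv⟩ := hδ.exists_vec
  refine ⟨v, fun f => ?_⟩
  rw [← hv]
  simp [δ]

/-- The value at `x` of the vector field corresponding to a derivation. -/
def derVec (X : Der A) (x : M) : TangentSpace (𝓡 4) x := (exists_derVec Φ X x).choose

theorem derVec_spec (X : Der A) (x : M) (f : A) : Φ (X f) x = dirDeriv (Φ f) x (derVec Φ X x) :=
  (exists_derVec Φ X x).choose_spec f

theorem vec_ext' {x : M} {v w : TangentSpace (𝓡 4) x}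
    (h : ∀ f : A, dirDeriv (Φ f) x v = dirDeriv (Φ f) x w) : v = w :=
  vec_ext fun f => by simpa using h (Φ.symm f)

theorem derVec_eq {X : Der A} {x : M} {v : TangentSpace (𝓡 4) x}
    (h : ∀ f : A, Φ (X f) x = dirDeriv (Φ f) x v) : derVec Φ X x = v :=
  vec_ext' Φ fun f => by rw [← derVec_spec, h]

theorem derVec_add (X Y : Der A) (x : M) : derVec Φ (X + Y) x = derVec Φ X x + derVec Φ Y x :=
  derVec_eq Φ fun f => by
    rw [dirDeriv_add_right, ← derVec_spec, ← derVec_spec, Derivation.add_apply, map_add]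
    rfl

theorem derVec_smul (a : A) (X : Der A) (x : M) : derVec Φ (a • X) x = Φ a x • derVec Φ X x :=
  derVec_eq Φ fun f => by
    rw [dirDeriv_smul_right, ← derVec_spec, Derivation.smul_apply, smul_eq_mul, map_mul]
    rfl

theorem derVec_real_smul (r : ℝ) (X : Der A) (x : M) :
    derVec Φ (r • X) x = r • derVec Φ X x :=
  derVec_eq Φ fun f => by
    rw [dirDeriv_smul_right, ← derVec_spec, Derivation.smul_apply, map_smul]
    rfl

theorem derVec_sum {ι : Type*} (s : Finset ι) (X : ι → Der A) (x : M) :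
    derVec Φ (∑ i ∈ s, X i) x = ∑ i ∈ s, derVec Φ (X i) x :=
  map_sum (AddMonoidHom.mk' (fun X => derVec Φ X x) fun X Y => derVec_add Φ X Y x) X s

theorem der_ext {X Y : Der A} (h : ∀ x, derVec Φ X x = derVec Φ Y x) : X = Y := by
  ext f
  apply Φ.injective
  ext x
  rw [derVec_spec, derVec_spec, h]

/-- The derivation given by a smooth vector field. -/
def ofField (V : VField M) : Der A :=
  Derivation.mk'
    { toFun f := Φ.symm (fieldDeriv V (Φ f))
      map_add' f g := by
        apply Φ.injective
        ext x
        simp only [AlgEquiv.apply_symm_apply, map_add]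
        exact (dirDerivHom x (V x)).map_add (Φ f) (Φ g)
      map_smul' r f := by
        apply Φ.injective
        ext x
        simp only [AlgEquiv.apply_symm_apply, map_smul]
        exact (dirDerivHom x (V x)).map_smul r (Φ f) }
    fun f g => by
      apply Φ.injective
      ext x
      simp only [LinearMap.coe_mk, AddHom.coe_mk, AlgEquiv.apply_symm_apply, map_add, smul_eq_mul,
        map_mul]
      exact isDerivationAt_dirDerivHom (V x) (Φ f) (Φ g)

@[simp] theorem derVec_ofField (V : VField M) (x : M) : derVec Φ (ofField Φ V) x = V x :=
  derVec_eq Φ fun f => by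
    change Φ (Φ.symm _) x = _
    rw [AlgEquiv.apply_symm_apply]
    rfl

theorem exists_der (x : M) (v : TangentSpace (𝓡 4) x) : ∃ X : Der A, derVec Φ X x = v := by
  obtain ⟨V, rfl⟩ := exists_field x v
  exact ⟨ofField Φ V, derVec_ofField Φ V x⟩

/-- The vector field corresponding to a derivation. -/
def toField (X : Der A) : VField M where
  toFun x := derVec Φ X x
  contMDiff_toFun := by
    intro x
    obtain ⟨F⟩ := exists_coordFrame x
    -- Near `x` the components of the field are the derivation's values on coordinate functions,
    -- which are smooth.
    have h : ContMDiff (𝓡 4) ((𝓡 4).prod 𝓘(ℝ, E 4)) ∞ fun y =>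
        Bundle.TotalSpace.mk' (E 4) (E := fun y : M => TangentSpace (𝓡 4) y) y
          (∑ j, Φ (X (Φ.symm (F.fn j))) y • F.field j y) :=
      ContMDiff.sum_section fun j _ =>
        (Φ (X (Φ.symm (F.fn j)))).contMDiff.smul_section (F.field j).contMDiff
    refine (h x).congr_of_eventuallyEq ?_
    filter_upwards [F.eq_sum] with y hy
    congr 1
    conv_lhs => rw [hy (derVec Φ X y)]
    refine Finset.sum_congr rfl fun j _ => ?_
    rw [derVec_spec, AlgEquiv.apply_symm_apply]

@[simp] theorem toField_apply (X : Der A) (x : M) : toField Φ X x = derVec Φ X x := rfl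

/-- Cutting off the frame expansion of `X` with a bump function gives an identity between
derivations of `A`, to which the `A`-linear `α` applies. At `x` all its coefficients vanish. -/
theorem dual_eq_zero_of_derVec_eq_zero (α : Der A →ₗ[A] A) {X : Der A} {x : M}
    (h : derVec Φ X x = 0) : Φ (α X) x = 0 := by
  obtain ⟨F⟩ := exists_coordFrame x
  obtain ⟨b, hb, hbU⟩ := exists_bump (n := 4) F.eq_sum
  have h1 : Φ.symm b • X = ∑ j, (Φ.symm b * X (Φ.symm (F.fn j))) • ofField Φ (F.field j) := by
    refine der_ext Φ fun y => ?_
    simp only [derVec_smul, derVec_sum, derVec_ofField, map_mul, AlgEquiv.apply_symm_apply,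
      SmoothFn.mul_apply, derVec_spec]
    by_cases hy : y ∈ tsupport b
    · conv_lhs => rw [hbU hy (derVec Φ X y)]
      simp only [Finset.smul_sum, smul_smul]
    · simp [image_eq_zero_of_notMem_tsupport hy]
  have h2 := congrArg (fun Y => Φ (α Y) x) h1
  simp only [map_smul, map_sum, smul_eq_mul, map_mul, AlgEquiv.apply_symm_apply,
    SmoothFn.mul_apply, SmoothFn.sum_apply, derVec_spec, h, hb.self_of_nhds, one_mul] at h2
  rw [h2]
  refine Finset.sum_eq_zero fun j _ => ?_
  have : dirDeriv (F.fn j) x 0 = 0 := map_zero (mfderiv (𝓡 4) 𝓘(ℝ, ℝ) (F.fn j) x)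
  rw [this, zero_mul]

theorem dual_congr (α : Der A →ₗ[A] A) {X Y : Der A} {x : M}
    (h : derVec Φ X x = derVec Φ Y x) : Φ (α X) x = Φ (α Y) x := by
  have h1 : derVec Φ (X - Y) x = 0 := by
    have := derVec_add Φ (X - Y) Y x
    rw [sub_add_cancel, h] at this
    simpa using this
  have h2 := dual_eq_zero_of_derVec_eq_zero Φ α h1
  rw [map_sub, map_sub] at h2
  exact sub_eq_zero.1 h2

/-- The covector at `x` given by a linear form on derivations. -/
def dualVec (α : Der A →ₗ[A] A) (x : M) : TangentSpace (𝓡 4) x →ₗ[ℝ] ℝ where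
  toFun v := Φ (α (exists_der Φ x v).choose) x
  map_add' v w := by
    rw [← SmoothFn.add_apply, ← map_add, ← map_add]
    refine dual_congr Φ α ?_
    rw [derVec_add, (exists_der Φ x _).choose_spec, (exists_der Φ x _).choose_spec,
      (exists_der Φ x _).choose_spec]
  map_smul' r v := by
    -- Linearity of `α` is over `A`, so the real scalar enters as a constant element of `A`.
    have : r * Φ (α (exists_der Φ x v).choose) x =
        Φ (α (algebraMap ℝ A r • (exists_der Φ x v).choose)) x := by
      rw [map_smul, smul_eq_mul, map_mul, SmoothFn.mul_apply, AlgEquiv.commutes]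
      rfl
    rw [RingHom.id_apply, smul_eq_mul, this]
    refine dual_congr Φ α ?_
    rw [algebraMap_smul, derVec_real_smul, (exists_der Φ x _).choose_spec,
      (exists_der Φ x _).choose_spec]

@[simp] theorem dualVec_derVec (α : Der A →ₗ[A] A) (X : Der A) (x : M) :
    dualVec Φ α x (derVec Φ X x) = Φ (α X) x :=
  dual_congr Φ α (exists_der Φ x _).choose_spec

/-- A tangent vector as a linear functional on the algebra. -/
def vecHom (x : M) : TangentSpace (𝓡 4) x →ₗ[ℝ] A →ₗ[ℝ] ℝ where
  toFun v := dirDerivHom x v ∘ₗ Φ.toLinearMap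
  map_add' v w := LinearMap.ext fun f => dirDeriv_add_right (Φ f) v w
  map_smul' r v := LinearMap.ext fun f => dirDeriv_smul_right (Φ f) r v

theorem range_vecHom (x : M) : LinearMap.range (vecHom Φ x) = tangentSpace (pointAt Φ x) := by
  ext ξ
  constructor
  · rintro ⟨v, rfl⟩
    obtain ⟨X, rfl⟩ := exists_der Φ x v
    exact ⟨X, LinearMap.ext fun f => derVec_spec Φ X x f⟩
  · rintro ⟨X, rfl⟩
    exact ⟨derVec Φ X x, LinearMap.ext fun f => (derVec_spec Φ X x f).symm⟩

/-- The identification of tangent vectors of the manifold and of the algebra. -/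
def vecEquiv (x : M) : TangentSpace (𝓡 4) x ≃ₗ[ℝ] tangentSpace (pointAt Φ x) :=
  (LinearEquiv.ofInjective (vecHom Φ x)
    fun _ _ h => vec_ext' Φ fun f => LinearMap.congr_fun h f).trans
      (LinearEquiv.ofEq _ _ (range_vecHom Φ x))

theorem vecEquiv_apply (x : M) (v : TangentSpace (𝓡 4) x) (f : A) :
    (vecEquiv Φ x v : A →ₗ[ℝ] ℝ) f = dirDeriv (Φ f) x v := rfl

theorem vecEquiv_derVec (x : M) (X : Der A) :
    (vecEquiv Φ x (derVec Φ X x) : A →ₗ[ℝ] ℝ) = evalDer (pointAt Φ x) X :=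
  LinearMap.ext fun f => (derVec_spec Φ X x f).symm

theorem derVec_eq_of_evalDer (x : M) {X : Der A} {v : TangentSpace (𝓡 4) x}
    (h : evalDer (pointAt Φ x) X = vecEquiv Φ x v) : derVec Φ X x = v :=
  (vecEquiv Φ x).injective (Subtype.ext ((vecEquiv_derVec Φ x X).trans h))

end Derivations

/-! ### Smooth fields of bilinear forms. -/

section Forms

variable {M : Type u} [TopologicalSpace M] [ChartedSpace (E 4) M] [IsManifold (𝓡 4) ∞ M]

theorem LorentzMetric.contMDiff_apply (g : LorentzMetric M) (V W : VField M) :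
    ContMDiff (𝓡 4) 𝓘(ℝ, ℝ) ∞ fun x => g.form x (V x) (W x) := by
  have h := ContMDiff.clm_bundle_apply₂ (F₃ := ℝ) (E₃ := fun _ : M => ℝ)
    g.contMDiff V.contMDiff W.contMDiff
  exact fun x => (Bundle.contMDiffAt_section _).1 (h x)

/-- The function `g(V, W)`. -/
def LorentzMetric.fieldForm (g : LorentzMetric M) (V W : VField M) : SmoothFn 4 M :=
  ⟨fun x => g.form x (V x) (W x), g.contMDiff_apply V W⟩

@[simp] theorem LorentzMetric.fieldForm_apply (g : LorentzMetric M) (V W : VField M) (x : M) :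
    g.fieldForm V W x = g.form x (V x) (W x) := rfl

theorem LorentzMetric.nondegenerate (g : LorentzMetric M) {x : M} {v : TangentSpace (𝓡 4) x}
    (h : ∀ w, g.form x v w = 0) : v = 0 := by
  obtain ⟨b, hb⟩ := g.lorentz x
  have h1 : ∀ j, b.repr v j = 0 := by
    intro j
    have h2 := h (b j)
    rw [← b.sum_repr v, map_sum, _root_.sum_apply] at h2
    simp only [map_smul, _root_.smul_apply, hb, minkowski, smul_eq_mul, mul_ite,
      mul_zero, Finset.sum_ite_eq', Finset.mem_univ, if_true] at h2
    split_ifs at h2 <;> simpa using h2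
  rw [← b.sum_repr v]
  simp [h1]

/-- A bilinear form on `ℝ⁴` as a combination of coordinate forms. -/
theorem bilin_eq_sum (T : E 4 →L[ℝ] E 4 →L[ℝ] ℝ) :
    T = ∑ i, ∑ j, T (EuclideanSpace.single i 1) (EuclideanSpace.single j 1) •
      (EuclideanSpace.proj (𝕜 := ℝ) i : E 4 →L[ℝ] ℝ).smulRight
        (EuclideanSpace.proj (𝕜 := ℝ) j : E 4 →L[ℝ] ℝ) := by
  ext v w
  have hv : ∀ u : E 4, u = ∑ i, u i • EuclideanSpace.single i (1 : ℝ) := by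
    intro u
    ext k
    simp [Pi.single_apply]
  conv_lhs => rw [hv v, hv w]
  simp only [map_sum, _root_.sum_apply, map_smul, _root_.smul_apply,
    smul_eq_mul, ContinuousLinearMap.smulRight_apply, Finset.mul_sum]
  rw [Finset.sum_comm]
  refine Finset.sum_congr rfl fun i _ => Finset.sum_congr rfl fun j _ => ?_
  simp only [PiLp.proj_apply]
  ring

variable [T2Space M]

/-- The matrix entries of `B` in the trivialization are, near `x`, its values on the frame fields,
so smoothness against vector fields gives smoothness as a section. -/
theorem contMDiff_form {B : ∀ x : M, TangentSpace (𝓡 4) x →L[ℝ] TangentSpace (𝓡 4) x →L[ℝ] ℝ}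
    (h : ∀ V W : VField M, ContMDiff (𝓡 4) 𝓘(ℝ, ℝ) ∞ fun x => B x (V x) (W x)) :
    ContMDiff (𝓡 4) ((𝓡 4).prod 𝓘(ℝ, E 4 →L[ℝ] E 4 →L[ℝ] ℝ)) ∞
      (fun x => Bundle.TotalSpace.mk' (E 4 →L[ℝ] E 4 →L[ℝ] ℝ)
        (E := fun x : M => TangentSpace (𝓡 4) x →L[ℝ] TangentSpace (𝓡 4) x →L[ℝ] ℝ) x (B x)) := by
  intro x
  rw [contMDiffAt_hom_bundle]
  refine ⟨contMDiffAt_id, ?_⟩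
  obtain ⟨F⟩ := exists_coordFrame x
  have h1 : ContMDiff (𝓡 4) 𝓘(ℝ, E 4 →L[ℝ] E 4 →L[ℝ] ℝ) ∞ fun y =>
      ∑ i, ∑ j, B y (F.field i y) (F.field j y) •
        (EuclideanSpace.proj (𝕜 := ℝ) i : E 4 →L[ℝ] ℝ).smulRight
          (EuclideanSpace.proj (𝕜 := ℝ) j : E 4 →L[ℝ] ℝ) :=
    contMDiff_finsetSum fun i _ => contMDiff_finsetSum fun j _ =>
      (h (F.field i) (F.field j)).smul contMDiff_const
  refine (h1 x).congr_of_eventuallyEq ?_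
  filter_upwards [F.field_eq, (trivializationAt (E 4) (TangentSpace (𝓡 4)) x).open_baseSet.mem_nhds
    (FiberBundle.mem_baseSet_trivializationAt' x)] with y hy hyt
  rw [bilin_eq_sum (ContinuousLinearMap.inCoordinates _ _ _ _ _ _ _ _ _)]
  refine Finset.sum_congr rfl fun i _ => Finset.sum_congr rfl fun j _ => ?_
  rw [inCoordinates_apply_eq₂ hyt hyt (mem_univ _), hy, hy]
  simp

end Forms

/-! ### From algebra metrics to Lorentzian metrics, and the matching of arrows. -/

section FormOfAlgMetric

variable {M : Type u} [TopologicalSpace M] [ChartedSpace (E 4) M] [IsManifold (𝓡 4) ∞ M]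
  [T2Space M] {A : Type u} [CommRing A] [Algebra ℝ A] (Φ : A ≃ₐ[ℝ] SmoothFn 4 M)

/-- A metric on the algebra and a metric on the manifold that correspond to each other. -/
def Compatible (γ : AlgMetric A) (g : LorentzMetric M) : Prop :=
  ∀ (X Y : Der A) (x : M), Φ (γ.toEquiv X Y) x = g.form x (derVec Φ X x) (derVec Φ Y x)

variable (γ : AlgMetric A)

theorem AlgMetric.congr {X X' Y Y' : Der A} {x : M} (hX : derVec Φ X x = derVec Φ X' x)
    (hY : derVec Φ Y x = derVec Φ Y' x) : Φ (γ.toEquiv X Y) x = Φ (γ.toEquiv X' Y') x := by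
  rw [dual_congr Φ _ hY, γ.symm, dual_congr Φ _ hX, γ.symm]

/-- By `AlgMetric.congr` the value at `x` depends only on the two vectors at `x`, so arbitrary
derivations extending them may be used, and bilinearity descends. -/
theorem AlgMetric.exists_bilin (x : M) :
    ∃ B : TangentSpace (𝓡 4) x →L[ℝ] TangentSpace (𝓡 4) x →L[ℝ] ℝ,
      ∀ X Y : Der A, B (derVec Φ X x) (derVec Φ Y x) = Φ (γ.toEquiv X Y) x := by
  let f : TangentSpace (𝓡 4) x → TangentSpace (𝓡 4) x → ℝ := fun v w =>
    Φ (γ.toEquiv (exists_der Φ x v).choose (exists_der Φ x w).choose) x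
  have hf : ∀ X Y : Der A, f (derVec Φ X x) (derVec Φ Y x) = Φ (γ.toEquiv X Y) x := fun X Y =>
    γ.congr Φ (exists_der Φ x _).choose_spec (exists_der Φ x _).choose_spec
  have hadd : ∀ v v' w, f (v + v') w = f v w + f v' w := by
    intro v v' w
    obtain ⟨X, rfl⟩ := exists_der Φ x v
    obtain ⟨X', rfl⟩ := exists_der Φ x v'
    obtain ⟨Y, rfl⟩ := exists_der Φ x w
    rw [← derVec_add, hf, hf, hf, map_add, LinearMap.add_apply, map_add]
    rfl
  have hsmul : ∀ (r : ℝ) v w, f (r • v) w = r • f v w := by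
    intro r v w
    obtain ⟨X, rfl⟩ := exists_der Φ x v
    obtain ⟨Y, rfl⟩ := exists_der Φ x w
    rw [← derVec_real_smul, hf, hf, ← algebraMap_smul A r X, map_smul, LinearMap.smul_apply,
      smul_eq_mul, map_mul, AlgEquiv.commutes]
    rfl
  have hsymm : ∀ v w, f v w = f w v := by
    intro v w
    obtain ⟨X, rfl⟩ := exists_der Φ x v
    obtain ⟨Y, rfl⟩ := exists_der Φ x w
    rw [hf, hf, γ.symm]
  refine ⟨(LinearMap.mk₂ ℝ f hadd hsmul (fun v w w' => ?_)
    (fun r v w => ?_)).toContinuousBilinearMap, hf⟩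
  · rw [hsymm, hadd, hsymm w, hsymm w']
  · rw [hsymm, hsmul, hsymm w]

theorem AlgMetric.exists_lorentzMetric (hγ : γ.IsLorentz) :
    ∃ g : LorentzMetric M, Compatible Φ γ g := by
  choose B hB using γ.exists_bilin Φ (M := M)
  refine ⟨⟨B, fun x v w => ?_, contMDiff_form fun V W => ?_, fun x => ?_⟩,
    fun X Y x => (hB x X Y).symm⟩
  · obtain ⟨X, rfl⟩ := exists_der Φ x v
    obtain ⟨Y, rfl⟩ := exists_der Φ x w
    rw [hB, hB, γ.symm]
  · refine (Φ (γ.toEquiv (ofField Φ V) (ofField Φ W))).contMDiff.congr fun x => ?_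
    rw [← hB, derVec_ofField, derVec_ofField]
  · obtain ⟨b, hb⟩ := hγ (pointAt Φ x)
    refine ⟨b.map (vecEquiv Φ x).symm, fun i j => ?_⟩
    obtain ⟨X, Y, hX, hY, h⟩ := hb i j
    have h1 : ∀ (k : Fin 4) {Z : Der A}, evalDer (pointAt Φ x) Z = b k →
        b.map (vecEquiv Φ x).symm k = derVec Φ Z x := by
      intro k Z hZ
      rw [Module.Basis.map_apply, LinearEquiv.symm_apply_eq]
      exact Subtype.ext (hZ.symm.trans (vecEquiv_derVec Φ x Z).symm)
    rw [h1 i hX, h1 j hY, hB, ← h]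
    rfl

theorem pointAt_surjective [SecondCountableTopology M] : Function.Surjective (pointAt Φ) := by
  intro p
  obtain ⟨x, hx⟩ := pointEval_surjective (pointsMap Φ.symm.toAlgHom p)
  refine ⟨x, Points.ext fun f => ?_⟩
  rw [pointAt_apply, ← pointEval_apply, hx]
  exact congrArg p (Φ.symm_apply_apply f)

variable {Φ} {γ} {g : LorentzMetric M}

/-- Turns the relation `AtPoint` into a single-valued form on tangent vectors. -/
theorem Compatible.atPoint_iff (h : Compatible Φ γ g) {x : M} {v w : TangentSpace (𝓡 4) x}
    {c : ℝ} : γ.AtPoint (pointAt Φ x) (vecEquiv Φ x v) (vecEquiv Φ x w) c ↔ g.form x v w = c := by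
  constructor
  · rintro ⟨X, Y, hX, hY, rfl⟩
    rw [← derVec_eq_of_evalDer Φ x hX, ← derVec_eq_of_evalDer Φ x hY, ← h]
    rfl
  · rintro rfl
    obtain ⟨X, rfl⟩ := exists_der Φ x v
    obtain ⟨Y, rfl⟩ := exists_der Φ x w
    exact ⟨X, Y, (vecEquiv_derVec Φ x X).symm, (vecEquiv_derVec Φ x Y).symm, h X Y x⟩

theorem Compatible.isLorentz [SecondCountableTopology M] (h : Compatible Φ γ g) :
    γ.IsLorentz := by
  intro p
  obtain ⟨x, rfl⟩ := pointAt_surjective Φ p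
  obtain ⟨b, hb⟩ := g.lorentz x
  exact ⟨b.map (vecEquiv Φ x), fun i j => h.atPoint_iff.2 (hb i j)⟩

/-- Pulling back functionals along `ψ` is the differential of `φ` on tangent vectors, by the chain
rule. All metric conditions on arrows, for `J`, `K`, `η` and `θ`, are read off from this
equivalence. -/
theorem Compatible.pushesForward_iff {N : Type u} [TopologicalSpace N] [ChartedSpace (E 4) N]
    [IsManifold (𝓡 4) ∞ N] [T2Space N] [SecondCountableTopology N]
    {B : Type u} [CommRing B] [Algebra ℝ B] {Ψ : B ≃ₐ[ℝ] SmoothFn 4 N} {δ : AlgMetric B}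
    {k : LorentzMetric N} (h : Compatible Φ γ g) (h' : Compatible Ψ δ k) {ψ : A →ₐ[ℝ] B}
    {φ : N → M} (hφ : ContMDiff (𝓡 4) (𝓡 4) ∞ φ) (hψ : ∀ f x, Ψ (ψ f) x = Φ f (φ x)) :
    PushesForward ψ γ δ ↔ ∀ (x : N) (v w : TangentSpace (𝓡 4) x),
      g.form (φ x) (mfderiv (𝓡 4) (𝓡 4) φ x v) (mfderiv (𝓡 4) (𝓡 4) φ x w) = k.form x v w := by
  have h1 : ∀ x, pointsMap ψ (pointAt Ψ x) = pointAt Φ (φ x) := fun x =>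
    Points.ext fun f => hψ f x
  have h2 : ∀ (X : Der B) (x : N), pullbackVec ψ (evalDer (pointAt Ψ x) X) =
      vecEquiv Φ (φ x) (mfderiv (𝓡 4) (𝓡 4) φ x (derVec Ψ X x)) := by
    intro X x
    ext f
    have h3 : (Ψ (ψ f) : N → ℝ) = Φ f ∘ φ := funext (hψ f)
    rw [vecEquiv_apply, ← dirDeriv_comp _ hφ, ← h3]
    exact derVec_spec Ψ X x (ψ f)
  have h3 : ∀ (X Y : Der B) (x : N), γ.AtPoint (pointsMap ψ (pointAt Ψ x))
      (pullbackVec ψ (evalDer (pointAt Ψ x) X)) (pullbackVec ψ (evalDer (pointAt Ψ x) Y))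
      (pointAt Ψ x (δ.toEquiv X Y)) ↔
      g.form (φ x) (mfderiv (𝓡 4) (𝓡 4) φ x (derVec Ψ X x))
        (mfderiv (𝓡 4) (𝓡 4) φ x (derVec Ψ Y x)) = k.form x (derVec Ψ X x) (derVec Ψ Y x) := by
    intro X Y x
    rw [h1, h2, h2, h.atPoint_iff, ← h']
    rfl
  constructor
  · intro H x v w
    obtain ⟨X, rfl⟩ := exists_der Ψ x v
    obtain ⟨Y, rfl⟩ := exists_der Ψ x w
    exact (h3 X Y x).1 (H X Y _)
  · intro H X Y q
    obtain ⟨x, rfl⟩ := pointAt_surjective Ψ q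
    exact (h3 X Y x).2 (H x _ _)

end FormOfAlgMetric

/-! ### From Lorentzian metrics to algebra metrics. -/

section AlgMetricOfForm

open Matrix

variable {M : Type u} [TopologicalSpace M] [ChartedSpace (E 4) M] [IsManifold (𝓡 4) ∞ M]

theorem LorentzMetric.exists_sharp (g : LorentzMetric M) (x : M)
    (α : TangentSpace (𝓡 4) x →ₗ[ℝ] ℝ) : ∃ v, ∀ w, g.form x v w = α w := by
  let L : TangentSpace (𝓡 4) x →ₗ[ℝ] Module.Dual ℝ (TangentSpace (𝓡 4) x) :=
    { toFun v := (g.form x v).toLinearMap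
      map_add' v w := by rw [map_add]; rfl
      map_smul' r v := by rw [map_smul]; rfl }
  have hL : Function.Injective L := by
    rw [← LinearMap.ker_eq_bot, LinearMap.ker_eq_bot']
    exact fun v hv => g.nondegenerate fun w => LinearMap.congr_fun hv w
  obtain ⟨v, hv⟩ := (LinearMap.injective_iff_surjective_of_finrank_eq_finrank
    Subspace.dual_finrank_eq.symm).1 hL α
  exact ⟨v, fun w => LinearMap.congr_fun hv w⟩

/-- The Gram matrix of a coordinate frame. -/
def LorentzMetric.gram (g : LorentzMetric M) {x : M} (F : CoordFrame x) :
    Matrix (Fin 4) (Fin 4) (SmoothFn 4 M) :=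
  .of fun i j => g.fieldForm (F.field i) (F.field j)

/-- Evaluation at a point as a ring homomorphism. -/
abbrev evalHom (y : M) : SmoothFn 4 M →+* ℝ :=
  ContMDiffMap.evalRingHom (I := 𝓡 4) (n := ∞) (R := ℝ) y

theorem LorentzMetric.gram_mulVec (g : LorentzMetric M) {x : M} (F : CoordFrame x) (y : M)
    (a : Fin 4 → ℝ) (i : Fin 4) : ((g.gram F).map (evalHom y) *ᵥ a) i =
      g.form y (∑ j, a j • F.field j y) (F.field i y) := by
  rw [g.symm, map_sum, mulVec, dotProduct]
  refine Finset.sum_congr rfl fun j _ => ?_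
  rw [map_smul, smul_eq_mul, mul_comm]
  rfl

/-- A kernel vector of the Gram matrix at `x` would give a combination of frame vectors orthogonal
to everything, hence zero, and the dual coordinate functions then read off zero coefficients. -/
theorem LorentzMetric.gram_det_ne_zero (g : LorentzMetric M) {x : M} (F : CoordFrame x) :
    (g.gram F).det x ≠ 0 := by
  intro h
  have h1 : ((g.gram F).map (evalHom x)).det = 0 := by
    rw [← h]
    exact ((evalHom x).map_det _).symm
  obtain ⟨a, ha, ha'⟩ := exists_mulVec_eq_zero_iff.2 h1
  have h2 : ∑ j, a j • F.field j x = 0 := by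
    refine g.nondegenerate fun w => ?_
    rw [F.eq_sum.self_of_nhds w, map_sum]
    refine Finset.sum_eq_zero fun i _ => ?_
    rw [map_smul, ← g.gram_mulVec, ha']
    simp
  refine ha (funext fun i => ?_)
  have h3 : dirDeriv (F.fn i) x (∑ j, a j • F.field j x) = a i := by
    rw [dirDeriv_sum_right]
    simp [dirDeriv_smul_right, F.dual.self_of_nhds]
  rw [← h3, h2]
  exact map_zero (mfderiv (𝓡 4) 𝓘(ℝ, ℝ) (F.fn i) x)

variable [T2Space M]

/-- The frame components of `V` solve a linear system with the Gram matrix and right-hand side `g(V,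
F.field i)`, all smooth; Cramer's rule gives smooth solutions where the determinant is nonzero. -/
theorem LorentzMetric.contMDiff_sharp (g : LorentzMetric M)
    {V : ∀ x : M, TangentSpace (𝓡 4) x}
    (hV : ∀ W : VField M, ContMDiff (𝓡 4) 𝓘(ℝ, ℝ) ∞ fun x => g.form x (V x) (W x)) :
    ContMDiff (𝓡 4) ((𝓡 4).prod 𝓘(ℝ, E 4)) ∞ fun x =>
      Bundle.TotalSpace.mk' (E 4) (E := fun x : M => TangentSpace (𝓡 4) x) x (V x) := by
  intro x
  obtain ⟨F⟩ := exists_coordFrame x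
  let β : Fin 4 → SmoothFn 4 M := fun i => ⟨fun y => g.form y (V y) (F.field i y), hV _⟩
  let a : Fin 4 → SmoothFn 4 M := (g.gram F).adjugate *ᵥ β
  have hdet := g.gram_det_ne_zero F
  have h : ContMDiffAt (𝓡 4) ((𝓡 4).prod 𝓘(ℝ, E 4)) ∞ (fun y =>
      Bundle.TotalSpace.mk' (E 4) (E := fun y : M => TangentSpace (𝓡 4) y) y
        (∑ j, (a j y / (g.gram F).det y) • F.field j y)) x :=
    ContMDiffAt.sum_section fun j _ =>
      ((a j).contMDiff.contMDiffAt.div₀ (g.gram F).det.contMDiff.contMDiffAt hdet).smul_section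
        (F.field j).contMDiff.contMDiffAt
  refine h.congr_of_eventuallyEq ?_
  filter_upwards [F.eq_sum, (g.gram F).det.contMDiff.continuous.continuousAt.eventually_ne hdet]
    with y hy hdy
  congr 1
  conv_lhs => rw [hy (V y)]
  refine Finset.sum_congr rfl fun j _ => ?_
  congr 1
  rw [eq_div_iff hdy]
  have h1 : (g.gram F).map (evalHom y) *ᵥ (fun j => dirDeriv (F.fn j) y (V y)) =
      fun i => β i y := by
    ext i
    rw [g.gram_mulVec, ← hy]
    rfl
  have h2 : a j y = (((g.gram F).map (evalHom y)).adjugate *ᵥ fun i => β i y) j := by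
    have := (evalHom y).map_mulVec (g.gram F).adjugate β j
    rw [← RingHom.mapMatrix_apply, ← RingHom.map_adjugate]
    exact this
  have h3 : (g.gram F).det y = ((g.gram F).map (evalHom y)).det 
      := (evalHom y).map_det (g.gram F)
  rw [h2, ← h1, mulVec_mulVec, adjugate_mul, smul_mulVec, one_mulVec, h3, Pi.smul_apply,
    smul_eq_mul, mul_comm]

variable {A : Type u} [CommRing A] [Algebra ℝ A] (Φ : A ≃ₐ[ℝ] SmoothFn 4 M)

/-- The map from derivations to linear forms on derivations given by a metric. -/
def LorentzMetric.flat (g : LorentzMetric M) : Der A →ₗ[A] Module.Dual A (Der A) :=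
  LinearMap.mk₂ A (fun X Y => Φ.symm (g.fieldForm (toField Φ X) (toField Φ Y)))
    (fun X X' Y => Φ.injective <| by
      ext x
      simp [derVec_add])
    (fun a X Y => Φ.injective <| by
      ext x
      simp [derVec_smul])
    (fun X Y Y' => Φ.injective <| by
      ext x
      simp [derVec_add])
    (fun a X Y => Φ.injective <| by
      ext x
      simp [derVec_smul])

theorem LorentzMetric.flat_apply (g : LorentzMetric M) (X Y : Der A) (x : M) :
    Φ (g.flat Φ X Y) x = g.form x (derVec Φ X x) (derVec Φ Y x) := by
  change Φ (Φ.symm _) x = _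
  rw [AlgEquiv.apply_symm_apply]
  rfl

/-- Injectivity is pointwise nondegeneracy. For surjectivity, a form `α` is represented by a vector
at each point, and the resulting field is smooth since its pairing with any smooth field `W` is `α`
applied to the derivation of `W`. -/
theorem LorentzMetric.flat_bijective (g : LorentzMetric M) :
    Function.Bijective (g.flat Φ) := by
  constructor
  · rw [injective_iff_map_eq_zero]
    intro X hX
    refine der_ext Φ fun x => ?_
    have h0 : derVec Φ (0 : Der A) x = 0 := derVec_eq Φ fun f => by
      rw [Derivation.zero_apply, map_zero]
      exact (map_zero (mfderiv (𝓡 4) 𝓘(ℝ, ℝ) (Φ f) x)).symm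
    rw [h0]
    refine g.nondegenerate fun w => ?_
    obtain ⟨Y, rfl⟩ := exists_der Φ x w
    rw [← g.flat_apply, hX, LinearMap.zero_apply, map_zero]
    rfl
  · intro α
    choose V hV using fun x => g.exists_sharp x (dualVec Φ α x)
    have hW : ∀ (W : VField M) (x : M), g.form x (V x) (W x) = Φ (α (ofField Φ W)) x := by
      intro W x
      rw [hV, ← derVec_ofField Φ W, dualVec_derVec]
    let V' : VField M := ⟨V, g.contMDiff_sharp fun W =>
      (Φ (α (ofField Φ W))).contMDiff.congr fun x => hW W x⟩
    refine ⟨ofField Φ V', LinearMap.ext fun Y => Φ.injective ?_⟩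
    ext x
    rw [g.flat_apply, derVec_ofField, ← dualVec_derVec]
    exact hV x _

theorem LorentzMetric.exists_algMetric (g : LorentzMetric M) :
    ∃ γ : AlgMetric A, Compatible Φ γ g := by
  refine ⟨⟨LinearEquiv.ofBijective _ (g.flat_bijective Φ), fun X Y => Φ.injective ?_⟩,
    g.flat_apply Φ⟩
  ext x
  exact (g.flat_apply Φ X Y x).trans ((g.symm x _ _).trans (g.flat_apply Φ Y X x).symm)

end AlgMetricOfForm

/-! ### The functors `J` and `K` and the two natural isomorphisms. -/

section Translations

/-- The metric of the Einstein algebra of a spacetime. -/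
def GR.algMetric (M : GR.{u}) : AlgMetric (SmoothFn 4 M) :=
  (M.metric.exists_algMetric AlgEquiv.refl).choose

theorem GR.compatible_algMetric (M : GR.{u}) :
    Compatible (AlgEquiv.refl (R := ℝ) (A₁ := SmoothFn 4 M)) M.algMetric M.metric :=
  (M.metric.exists_algMetric AlgEquiv.refl).choose_spec

/-- The metric of the spacetime of an Einstein algebra. -/
def EA.lorentzMetric (A : EA.{u}) : LorentzMetric (Points A) :=
  (A.metric.exists_lorentzMetric A.equivSmoothFn A.lorentz).choose

theorem EA.compatible_lorentzMetric (A : EA.{u}) :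
    Compatible A.equivSmoothFn A.metric A.lorentzMetric :=
  (A.metric.exists_lorentzMetric A.equivSmoothFn A.lorentz).choose_spec

/-- The translation from spacetimes to Einstein algebras. -/
def translationJ : TranslationJ.{u} where
  smooth M := isSmoothAlg_smoothFn 4 M
  metric M := M.algMetric
  metric_spec M X Y x := ⟨_, _, derVec_spec AlgEquiv.refl X x, derVec_spec AlgEquiv.refl Y x,
    M.compatible_algMetric X Y x⟩
  lorentz M := M.compatible_algMetric.isLorentz
  pushes {M N} φ := (N.compatible_algMetric.pushesForward_iff M.compatible_algMetric
    φ.isometry.contMDiff fun _ _ => rfl).2 φ.isometry.pullback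

theorem EA.contMDiff_pointsMap {A B : EA.{u}} (ψ : A →ₐ[ℝ] B) :
    ContMDiff (𝓡 4) (𝓡 4) ∞ (pointsMap ψ) := by
  refine contMDiff_of_comp_smoothFn
    (Points.continuous_iff.2 fun f => Points.continuous_apply (ψ f)) fun F => ?_
  obtain ⟨f, rfl⟩ := A.equivSmoothFn.surjective F
  -- Composing the function of `f` on `|A|` with `|ψ|` gives the function of `ψ f` on `|B|`.
  exact EA.contMDiff_apply B (ψ f)

/-- The translation from Einstein algebras to spacetimes. -/
def translationK : TranslationK.{u} where
  metric A := A.lorentzMetric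
  metric_spec A p v w := by
    obtain ⟨X, rfl⟩ := exists_der A.equivSmoothFn p v
    obtain ⟨Y, rfl⟩ := exists_der A.equivSmoothFn p w
    exact ⟨X, Y, derVec_spec A.equivSmoothFn X p, derVec_spec A.equivSmoothFn Y p,
      (A.compatible_lorentzMetric X Y p).symm⟩
  isometry {A B} ψ := ⟨EA.contMDiff_pointsMap ψ.toAlgHom,
    (A.compatible_lorentzMetric.pushesForward_iff B.compatible_lorentzMetric
      (EA.contMDiff_pointsMap ψ.toAlgHom) fun _ _ => rfl).1 ψ.pushes⟩

/-- The Einstein algebra of a spacetime. -/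
abbrev GR.toEA (M : GR.{u}) : EA.{u} := translationJ.functor.obj (op M)

/-- The spacetime of an Einstein algebra. -/
abbrev EA.toGR (A : EA.{u}) : GR.{u} := translationK.functor.obj (op A)

theorem id_pullback {M : Type u} [TopologicalSpace M] [ChartedSpace (E 4) M]
    [IsManifold (𝓡 4) ∞ M] (g : LorentzMetric M) (x : M) (v w : TangentSpace (𝓡 4) x) :
    g.form (id x) (mfderiv (𝓡 4) (𝓡 4) id x v) (mfderiv (𝓡 4) (𝓡 4) id x w) = g.form x v w := by
  simp [mfderiv_id]

/-- The underlying map of spaces is the identity of `|A|`, and both algebra metrics are compatible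
with the same Lorentzian metric. -/
theorem EA.pushes_equivSmoothFn (A : EA.{u}) :
    PushesForward A.equivSmoothFn.toAlgHom A.metric A.toGR.algMetric :=
  (A.compatible_lorentzMetric.pushesForward_iff A.toGR.compatible_algMetric contMDiff_id
    fun _ _ => rfl).2 (id_pullback _)

theorem EA.pushes_equivSmoothFn_symm (A : EA.{u}) :
    PushesForward A.equivSmoothFn.symm.toAlgHom A.toGR.algMetric A.metric :=
  (A.toGR.compatible_algMetric.pushesForward_iff A.compatible_lorentzMetric contMDiff_id
    fun f x => DFunLike.congr_fun (A.equivSmoothFn.apply_symm_apply f) x).2 (id_pullback _)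

/-- The points of a spacetime as the points of its Einstein algebra. -/
def GR.toPoints (M : GR.{u}) : M ≃ₜ Points M.toEA := pointHomeo 4 M

theorem GR.apply_toPoints_symm (M : GR.{u}) (p : Points M.toEA) (f : SmoothFn 4 M) :
    f (M.toPoints.symm p) = M.toEA.equivSmoothFn f p := apply_pointHomeo_symm p f

theorem GR.contMDiff_toPoints (M : GR.{u}) : ContMDiff (𝓡 4) (𝓡 4) ∞ M.toPoints := by
  refine contMDiff_of_comp_smoothFn M.toPoints.continuous fun F => ?_
  obtain ⟨f, rfl⟩ := M.toEA.equivSmoothFn.surjective F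
  exact ContMDiffMap.contMDiff (show SmoothFn 4 M from f)

theorem GR.contMDiff_toPoints_symm (M : GR.{u}) : ContMDiff (𝓡 4) (𝓡 4) ∞ M.toPoints.symm :=
  contMDiff_of_comp_smoothFn M.toPoints.symm.continuous fun f =>
    (M.toEA.equivSmoothFn f).contMDiff.congr fun p => M.apply_toPoints_symm p f

/-- Here the algebra side is the identity of `C^∞(M)`, which trivially preserves the metric; the
equivalence of arrow conditions converts this into an isometry. -/
theorem GR.isIsometry_toPoints (M : GR.{u}) :
    IsIsometry M.metric M.toEA.lorentzMetric M.toPoints :=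
  ⟨M.contMDiff_toPoints, (M.toEA.compatible_lorentzMetric.pushesForward_iff
    M.compatible_algMetric (ψ := AlgHom.id ℝ _) M.contMDiff_toPoints fun _ _ => rfl).1
      fun X Y _ => ⟨X, Y, rfl, rfl, rfl⟩⟩

theorem GR.isIsometry_toPoints_symm (M : GR.{u}) :
    IsIsometry M.toEA.lorentzMetric M.metric M.toPoints.symm :=
  ⟨M.contMDiff_toPoints_symm, (M.compatible_algMetric.pushesForward_iff
    M.toEA.compatible_lorentzMetric (ψ := AlgHom.id ℝ _) M.contMDiff_toPoints_symm
      fun f p => (M.apply_toPoints_symm p f).symm).1 fun X Y _ => ⟨X, Y, rfl, rfl, rfl⟩⟩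

/-- The natural isomorphism `A ≅ C^∞(|A|)`. -/
def etaIso : 𝟭 EA.{u} ≅ translationK.functor.rightOp ⋙ translationJ.functor :=
  NatIso.ofComponents
    (fun A =>
      { hom := ⟨A.equivSmoothFn.toAlgHom, A.pushes_equivSmoothFn⟩
        inv := ⟨A.equivSmoothFn.symm.toAlgHom, A.pushes_equivSmoothFn_symm⟩
        hom_inv_id := EA.Hom.ext (AlgHom.ext A.equivSmoothFn.symm_apply_apply)
        inv_hom_id := EA.Hom.ext (AlgHom.ext A.equivSmoothFn.apply_symm_apply) })
    fun _ => rfl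

/-- The natural isomorphism `M ≅ |C^∞(M)|`. -/
def thetaIso : 𝟭 GR.{u} ≅ translationJ.functor.rightOp ⋙ translationK.functor :=
  NatIso.ofComponents
    (fun M =>
      { hom := ⟨M.toPoints, M.isIsometry_toPoints⟩
        inv := ⟨M.toPoints.symm, M.isIsometry_toPoints_symm⟩
        hom_inv_id := GR.Hom.ext (funext M.toPoints.symm_apply_apply)
        inv_hom_id := GR.Hom.ext (funext M.toPoints.apply_symm_apply) })
    fun _ => rfl

end Translations

end

end EinsteinAlg

open EinsteinAlg
theorem mainTheorem1 :
    AreDual EA.{u} GR.{u} ∧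
    ∃ (J : TranslationJ.{u}) (K : TranslationK.{u})
      (η : 𝟭 EA.{u} ≅ K.functor.rightOp ⋙ J.functor)
      (θ : 𝟭 GR.{u} ≅ J.functor.rightOp ⋙ K.functor),
      (∀ (A : EA.{u}) (f : A) (p : Points A),
        DFunLike.coe (F := SmoothFn 4 (Points A)) ((η.hom.app A).toAlgHom f) p = p f) ∧
      (∀ (M : GR.{u}) (x : M) (f : SmoothFn 4 M),
        DFunLike.coe (F := Points (SmoothFn 4 M)) ((θ.hom.app M).toFun x) f = f x) :=
  ⟨⟨translationK.functor, translationJ.functor, ⟨etaIso⟩, ⟨thetaIso⟩⟩,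
    translationJ, translationK, etaIso, thetaIso, fun _ _ _ => rfl, fun _ _ _ => rfl⟩
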